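/- Let $N\ge 2$, let $\Omega\subset\mathbb R^N$ be a bounded domain and let $s\in(0,1)$. Let $\varphi:\mathbb R^N\times\mathbb R^N\times(0,\infty)\to[0,\infty)$, write $\varphi_{x,y}(t)=\varphi(x,y,t)$ and put $\Phi_{x,y}(t)=\int_0^{|t|}\tau\varphi_{x,y}(\tau)\,d\tau$ and $\widehat\Phi_x=\Phi_{x,x}$. For each $t$ let $(x,y)\mapsto\Phi_{x,y}(t)$ and $x\mapsto\widehat\Phi_x(t)$ be Lebesgue measurable. Assume that for all $x,y$: * $(\varphi_1)$ $t\mapsto\varphi_{x,y}(t)$ is continuous on $(0,\infty)$, $\lim_{t\to0^+}t\varphi_{x,y}(t)=0$ and $\lim_{t\to\infty}t\varphi_{x,y}(t)=\infty$; * $(\varphi_2)$ $t\mapsto t\varphi_{x,y}(t)$ is nondecreasing on $(0,\infty)$; * $(\varphi_3)$ there are constants $1<\ell\le m<\infty$, independent of $x,y,t$, with $\ell\le t^2\varphi_{x,y}(t)/\Phi_{x,y}(t)\le m$ for all $t>0$; and that there are constants $C_1, C_2$ with $0<C_1\le\Phi_{x,y}(1)\le C_2$ for all $(x,y)\in\Omega\times\Omega$.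 For a measurable $u$ put $D_su(x,y)=\dfrac{u(x)-u(y)}{|x-y|^s}$ and $d\mu=\dfrac{dx\,dy}{|x-y|^N}$. Let $W_0^{s,\Phi_{x,y}}(\Omega)$ be the space of all measurable $u:\mathbb R^N\to\mathbb R$ with $u=0$ a.e. in $\mathbb R^N\setminus\Omega$ such that $\int_{\mathbb R^N}\widehat\Phi_x(\lambda u(x))\,dx<\infty$ and $\int_{\mathbb R^N}\int_{\mathbb R^N}\Phi_{x,y}(\lambda D_su(x,y))\,d\mu<\infty$ for some $\lambda>0$. Let $$J_{s,\Phi}(u)=\int_\Omega\int_\Omega\Phi_{x,y}(D_su(x,y))\,d\mu ,$$ and equip $W_0^{s,\Phi_{x,y}}(\Omega)$ with the Gagliardo (semi)norm $\|u\|=\inf\{\lambda>0: J_{s,\Phi}(u/\lambda)\le1\}$; weak and strong convergence and the dual space are meant with respect to it. Then $J_{s,\Phi}$ is Gâteaux differentiable on $W_0^{s,\Phi_{x,y}}(\Omega)$, and its derivative $J'_{s,\Phi}:W_0^{s,\Phi_{x,y}}(\Omega)\to\big(W_0^{s,\Phi_{x,y}}(\Omega)\big)^*$ has the $(S_+)$-property: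 if $u_n\rightharpoonup u$ weakly in $W_0^{s,\Phi_{x,y}}(\Omega)$ and $\limsup_{n\to\infty}\langle J'_{s,\Phi}(u_n),u_n-u\rangle\le0$, then $u_n\to u$ strongly in $W_0^{s,\Phi_{x,y}}(\Omega)$. -/

import Mathlib

open MeasureTheory Set Filter Topology
open scoped ENNReal

noncomputable section

namespace FracMusielak

/-- The Euclidean space `ℝ^N`. -/
abbrev E (N : ℕ) : Type := EuclideanSpace ℝ (Fin N)

/-- `Φ_{x,y}(t) = ∫_0^{|t|} τ φ_{x,y}(τ) dτ`. -/
def Phi {N : ℕ} (φ : E N → E N → ℝ → ℝ) (x y : E N) (t : ℝ) : ℝ :=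
  ∫ τ in (0 : ℝ)..|t|, τ * φ x y τ

/-- The structural assumptions on `φ : ℝ^N × ℝ^N × (0,∞) → [0,∞)`; the values of `φ x y t` for
`t ≤ 0` play no role. Measurability is Lebesgue measurability, asked of `(x,y) ↦ Φ_{x,y}(t)` and
of the diagonal function `x ↦ Φ_{x,x}(t)`. -/
structure IsAdmissible {N : ℕ} (φ : E N → E N → ℝ → ℝ) : Prop where
  nonneg : ∀ x y t, 0 < t → 0 ≤ φ x y t
  aemeasurable : ∀ t : ℝ, AEMeasurable (fun p : E N × E N => Phi φ p.1 p.2 t)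
    ((volume : Measure (E N)).prod volume)
  aemeasurable_diag : ∀ t : ℝ, AEMeasurable (fun x : E N => Phi φ x x t) volume
  continuousOn : ∀ x y, ContinuousOn (φ x y) (Ioi 0)
  tendsto_zero : ∀ x y, Tendsto (fun t => t * φ x y t) (𝓝[>] 0) (𝓝 0)
  tendsto_atTop : ∀ x y, Tendsto (fun t => t * φ x y t) atTop atTop
  /-- `t ↦ t φ_{x,y}(t)` is nondecreasing -/
  monotoneOn : ∀ x y, MonotoneOn (fun t => t * φ x y t) (Ioi 0)
  /-- `l` and `m` do not depend on `x`, `y`, `t`; the lower bound forces `Φ_{x,y}(t) ≠ 0` -/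
  growth : ∃ l m : ℝ, 1 < l ∧ l ≤ m ∧ ∀ x y t, 0 < t →
    l ≤ t ^ 2 * φ x y t / Phi φ x y t ∧ t ^ 2 * φ x y t / Phi φ x y t ≤ m

/-- `0 < C₁ ≤ Φ_{x,y}(1) ≤ C₂` on `Ω × Ω`. -/
def FracBounded {N : ℕ} (φ : E N → E N → ℝ → ℝ) (Ω : Set (E N)) : Prop :=
  ∃ C₁ C₂ : ℝ, 0 < C₁ ∧ ∀ x ∈ Ω, ∀ y ∈ Ω, C₁ ≤ Phi φ x y 1 ∧ Phi φ x y 1 ≤ C₂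

/-- `D_s u (x,y) = (u(x) - u(y)) / |x-y|^s`. -/
def Ds {N : ℕ} (s : ℝ) (u : E N → ℝ) (p : E N × E N) : ℝ :=
  (u p.1 - u p.2) / ‖p.1 - p.2‖ ^ s

/-- The measure `dμ = dx dy / |x-y|^N` on `A × A`. -/
def gagliardoMeasure {N : ℕ} (A : Set (E N)) : Measure (E N × E N) :=
  (((volume : Measure (E N)).prod volume).restrict (A ×ˢ A)).withDensity
    (fun p => ENNReal.ofReal (1 / ‖p.1 - p.2‖ ^ N))

/-- The Gagliardo modular `∫_A ∫_A Φ_{x,y}(D_s u(x,y)) dμ`, with values in `[0,∞]`. -/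
def modular {N : ℕ} (φ : E N → E N → ℝ → ℝ) (s : ℝ) (A : Set (E N)) (u : E N → ℝ) : ℝ≥0∞ :=
  ∫⁻ p, ENNReal.ofReal (Phi φ p.1 p.2 (Ds s u p)) ∂(gagliardoMeasure A)

/-- The Musielak-Orlicz modular `∫_A Φ_{x,x}(u(x)) dx`. -/
def modularHat {N : ℕ} (φ : E N → E N → ℝ → ℝ) (A : Set (E N)) (u : E N → ℝ) : ℝ≥0∞ :=
  ∫⁻ x in A, ENNReal.ofReal (Phi φ x x (u x))

/-- Membership in the fractional Musielak-Sobolev space `W^{s,Φ_{x,y}}(A)`. -/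
def MemW {N : ℕ} (φ : E N → E N → ℝ → ℝ) (s : ℝ) (A : Set (E N)) (u : E N → ℝ) : Prop :=
  AEMeasurable u (volume.restrict A) ∧
  (∃ c : ℝ, 0 < c ∧ modularHat φ A (c • u) < ∞) ∧
  (∃ c : ℝ, 0 < c ∧ modular φ s A (c • u) < ∞)

/-- The `(s,Φ_{x,y})`-Gagliardo (Luxemburg) seminorm over `A × A`. -/
def gagliardoSeminorm {N : ℕ} (φ : E N → E N → ℝ → ℝ) (s : ℝ) (A : Set (E N))
    (u : E N → ℝ) : ℝ :=
  sInf {c : ℝ | 0 < c ∧ modular φ s A (c⁻¹ • u) ≤ 1}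

section Aux

variable {N : ℕ} {φ : E N → E N → ℝ → ℝ}

theorem Phi_zero (x y : E N) : Phi φ x y 0 = 0 := by simp [Phi]

theorem Phi_abs (x y : E N) (t : ℝ) : Phi φ x y |t| = Phi φ x y t := by simp [Phi]

theorem IsAdmissible.monotoneOn_Ici (h : IsAdmissible φ) (x y : E N) :
    MonotoneOn (fun t => t * φ x y t) (Ici 0) := by
  intro a ha b hb hab
  rcases eq_or_lt_of_le (show (0 : ℝ) ≤ a from ha) with rfl | ha'
  · rcases eq_or_lt_of_le (show (0 : ℝ) ≤ b from hb) with rfl | hb'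
    · exact le_rfl
    · simpa using mul_nonneg hb'.le (h.nonneg x y b hb')
  · exact h.monotoneOn x y ha' (ha'.trans_le hab) hab

theorem IsAdmissible.intervalIntegrable (h : IsAdmissible φ) (x y : E N) {a b : ℝ}
    (ha : 0 ≤ a) (hb : 0 ≤ b) : IntervalIntegrable (fun t => t * φ x y t) volume a b := by
  apply MonotoneOn.intervalIntegrable
  apply (h.monotoneOn_Ici x y).mono
  intro z hz
  exact le_trans (le_min ha hb) hz.1

theorem IsAdmissible.convexOn_Ici (h : IsAdmissible φ) (x y : E N) :
    ConvexOn ℝ (Ici 0) (fun r : ℝ => ∫ τ in (0 : ℝ)..r, τ * φ x y τ) := by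
  have hd : ∀ r : ℝ, 0 < r →
      HasDerivAt (fun r : ℝ => ∫ τ in (0 : ℝ)..r, τ * φ x y τ) (r * φ x y r) r := by
    intro r hr
    have hc : ContinuousOn (fun t => t * φ x y t) (Ioi 0) :=
      continuousOn_id.mul (h.continuousOn x y)
    exact intervalIntegral.integral_hasDerivAt_right (h.intervalIntegrable x y le_rfl hr.le)
      (hc.stronglyMeasurableAtFilter isOpen_Ioi r hr) (hc.continuousAt (Ioi_mem_nhds hr))
  apply MonotoneOn.convexOn_of_deriv (convex_Ici 0)
  · intro r hr
    have hi : IntegrableOn (fun t => t * φ x y t) (uIcc 0 (r + 1)) := by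
      have := h.intervalIntegrable x y le_rfl (show (0 : ℝ) ≤ r + 1 by
        have : (0 : ℝ) ≤ r := hr
        linarith)
      rwa [intervalIntegrable_iff'] at this
    have := intervalIntegral.continuousOn_primitive_interval hi
    have hr0 : (0 : ℝ) ≤ r := hr
    rw [uIcc_of_le (by linarith)] at this
    have h1 := this r ⟨hr0, by linarith⟩
    refine h1.mono_of_mem_nhdsWithin ?_
    have : Iio (r + 1) ∈ 𝓝 r := Iio_mem_nhds (by linarith)
    filter_upwards [mem_nhdsWithin_of_mem_nhds this, self_mem_nhdsWithin] with z hz hz'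
    exact ⟨hz', le_of_lt hz⟩
  · rw [interior_Ici]
    intro r hr
    exact (hd r hr).differentiableAt.differentiableWithinAt
  · rw [interior_Ici]
    intro a ha b hb hab
    rw [(hd a ha).deriv, (hd b hb).deriv]
    exact h.monotoneOn x y ha hb hab

theorem IsAdmissible.Phi_nonneg (h : IsAdmissible φ) (x y : E N) (t : ℝ) : 0 ≤ Phi φ x y t := by
  apply intervalIntegral.integral_nonneg (abs_nonneg t)
  intro r hr
  simpa using h.monotoneOn_Ici x y (mem_Ici.2 le_rfl) (mem_Ici.2 hr.1) hr.1

theorem IsAdmissible.Phi_mono (h : IsAdmissible φ) (x y : E N) {a b : ℝ} (hab : |a| ≤ |b|) :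
    Phi φ x y a ≤ Phi φ x y b := by
  apply intervalIntegral.integral_mono_interval le_rfl (abs_nonneg a) hab
  · filter_upwards [ae_restrict_mem measurableSet_Ioc] with r hr
    simpa using mul_nonneg hr.1.le (h.nonneg x y r hr.1)
  · exact h.intervalIntegrable x y le_rfl (abs_nonneg b)

theorem IsAdmissible.Phi_convex (h : IsAdmissible φ) (x y : E N) (a b : ℝ) {c d : ℝ}
    (hc : 0 ≤ c) (hd : 0 ≤ d) (hcd : c + d = 1) :
    Phi φ x y (c * a + d * b) ≤ c * Phi φ x y a + d * Phi φ x y b := by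
  have h1 : |c * a + d * b| ≤ |(c * |a| + d * |b|)| := by
    rw [abs_of_nonneg (show 0 ≤ c * |a| + d * |b| by positivity)]
    calc |c * a + d * b| ≤ |c * a| + |d * b| := abs_add_le _ _
      _ = c * |a| + d * |b| := by rw [abs_mul, abs_mul, abs_of_nonneg hc, abs_of_nonneg hd]
  refine (h.Phi_mono x y h1).trans ?_
  have h2 := (h.convexOn_Ici x y).2 (mem_Ici.2 (abs_nonneg a)) (mem_Ici.2 (abs_nonneg b)) hc hd hcd
  simp only [smul_eq_mul] at h2
  unfold Phi
  rwa [abs_of_nonneg (show 0 ≤ c * |a| + d * |b| by positivity)]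

theorem IsAdmissible.Phi_continuous (h : IsAdmissible φ) (x y : E N) :
    Continuous (Phi φ x y) := by
  have hc : ConvexOn ℝ univ (Phi φ x y) :=
    ⟨convex_univ, fun a _ b _ c d hc hd hcd => h.Phi_convex x y a b hc hd hcd⟩
  exact continuousOn_univ.1 (hc.continuousOn isOpen_univ)

/-- A composition rule for functions continuous in `t` and almost everywhere measurable in the
other variable. -/
theorem aemeasurable_comp_of_continuous {α : Type*} [MeasurableSpace α] {ν : Measure α}
    {F : α → ℝ → ℝ} (hc : ∀ a, Continuous (F a)) (hm : ∀ t, AEMeasurable (fun a => F a t) ν)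
    {g : α → ℝ} (hg : AEMeasurable g ν) : AEMeasurable (fun a => F a (g a)) ν := by
  have hae : ∀ᵐ a ∂ν, ∀ q : ℚ, F a q = (hm q).mk _ a :=
    ae_all_iff.2 fun q => (hm q).ae_eq_mk
  obtain ⟨S, hS, hSm, hS0⟩ := exists_measurable_superset_of_null (ae_iff.1 hae)
  have hS' : ∀ a, a ∉ S → ∀ q : ℚ, F a q = (hm q).mk _ a := by
    intro a ha
    by_contra hcon
    exact ha (hS hcon)
  let F' : ℝ → α → ℝ := fun t a => Sᶜ.indicator (fun a => F a t) a
  have hq : ∀ q : ℚ, Measurable (F' q) := by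
    intro q
    have : F' q = Sᶜ.indicator ((hm q).mk _) := by
      funext a
      by_cases ha : a ∈ S
      · simp [F', ha]
      · simp [F', ha, hS' a ha q]
    rw [this]
    exact (hm q).measurable_mk.indicator hSm.compl
  have hcont : ∀ a, Continuous fun t => F' t a := by
    intro a
    by_cases ha : a ∈ S
    · simpa [F', ha] using continuous_const
    · simpa [F', ha] using hc a
  have hmeas : ∀ t, Measurable (F' t) := by
    intro t
    obtain ⟨r, hr⟩ : ∃ r : ℕ → ℚ, Tendsto (fun n => (r n : ℝ)) atTop (𝓝 t) := by
      obtain ⟨r, -, -, hr⟩ := Real.exists_seq_rat_strictMono_tendsto t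
      exact ⟨r, hr⟩
    refine measurable_of_tendsto_metrizable (fun n => hq (r n)) ?_
    rw [tendsto_pi_nhds]
    intro a
    exact ((hcont a).tendsto t).comp hr
  have hunc := measurable_uncurry_of_continuous_of_measurable hcont hmeas
  refine ⟨fun a => F' (hg.mk g a) a, hunc.comp (hg.measurable_mk.prodMk measurable_id), ?_⟩
  filter_upwards [hg.ae_eq_mk, measure_eq_zero_iff_ae_notMem.1 hS0] with a ha ha'
  simp [F', ha', ← ha]

theorem gagliardoMeasure_ac (A : Set (E N)) :
    gagliardoMeasure A ≪ ((volume : Measure (E N)).prod volume) :=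
  (withDensity_absolutelyContinuous _ _).trans Measure.restrict_le_self.absolutelyContinuous

theorem aemeasurable_Ds (s : ℝ) {u : E N → ℝ} (hu : AEMeasurable u volume) :
    AEMeasurable (Ds s u) ((volume : Measure (E N)).prod volume) := by
  have h1 : AEMeasurable (fun p : E N × E N => u p.1) (volume.prod volume) :=
    hu.comp_quasiMeasurePreserving Measure.quasiMeasurePreserving_fst
  have h2 : AEMeasurable (fun p : E N × E N => u p.2) (volume.prod volume) :=
    hu.comp_quasiMeasurePreserving Measure.quasiMeasurePreserving_snd
  have h3 : Measurable (fun p : E N × E N => ‖p.1 - p.2‖ ^ s) :=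
    (measurable_fst.sub measurable_snd).norm.pow_const s
  exact (h1.sub h2).div h3.aemeasurable

theorem IsAdmissible.aemeasurable_integrand (h : IsAdmissible φ) (s : ℝ) (A : Set (E N))
    {u : E N → ℝ} (hu : AEMeasurable u volume) :
    AEMeasurable (fun p => ENNReal.ofReal (Phi φ p.1 p.2 (Ds s u p))) (gagliardoMeasure A) :=
  ((aemeasurable_comp_of_continuous (F := fun p : E N × E N => Phi φ p.1 p.2)
    (fun p => h.Phi_continuous p.1 p.2) h.aemeasurable
    (aemeasurable_Ds s hu)).ennreal_ofReal).mono_ac (gagliardoMeasure_ac A)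

theorem Ds_add (s : ℝ) (u v : E N → ℝ) (p : E N × E N) :
    Ds s (u + v) p = Ds s u p + Ds s v p := by
  simp only [Ds, Pi.add_apply]; ring

theorem Ds_smul (s c : ℝ) (u : E N → ℝ) (p : E N × E N) : Ds s (c • u) p = c * Ds s u p := by
  simp only [Ds, Pi.smul_apply, smul_eq_mul]; ring

theorem IsAdmissible.modular_convex (h : IsAdmissible φ) (s : ℝ) (A : Set (E N))
    {u v : E N → ℝ} (hu : AEMeasurable u volume) {c d : ℝ}
    (hc : 0 ≤ c) (hd : 0 ≤ d) (hcd : c + d = 1) :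
    modular φ s A (c • u + d • v) ≤
      ENNReal.ofReal c * modular φ s A u + ENNReal.ofReal d * modular φ s A v := by
  unfold modular
  rw [← lintegral_const_mul' _ _ ENNReal.ofReal_ne_top,
    ← lintegral_const_mul' _ _ ENNReal.ofReal_ne_top,
    ← lintegral_add_left' ((h.aemeasurable_integrand s A hu).const_mul _)]
  refine lintegral_mono fun p => ?_
  rw [← ENNReal.ofReal_mul hc, ← ENNReal.ofReal_mul hd,
    ← ENNReal.ofReal_add (mul_nonneg hc (h.Phi_nonneg _ _ _)) (mul_nonneg hd (h.Phi_nonneg _ _ _)),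
    Ds_add, Ds_smul, Ds_smul]
  exact ENNReal.ofReal_le_ofReal (h.Phi_convex _ _ _ _ hc hd hcd)

theorem IsAdmissible.modular_mono (h : IsAdmissible φ) (s : ℝ) (A : Set (E N))
    (u : E N → ℝ) {c d : ℝ} (hcd : |c| ≤ |d|) :
    modular φ s A (c • u) ≤ modular φ s A (d • u) := by
  refine lintegral_mono fun p => ENNReal.ofReal_le_ofReal (h.Phi_mono _ _ ?_)
  rw [Ds_smul, Ds_smul, abs_mul, abs_mul]
  exact mul_le_mul_of_nonneg_right hcd (abs_nonneg _)

theorem modular_mono_set (s : ℝ) {A B : Set (E N)} (hAB : A ⊆ B) (u : E N → ℝ) :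
    modular φ s A u ≤ modular φ s B u :=
  lintegral_mono' (Measure.le_iff.2 fun t ht => by
    rw [gagliardoMeasure, gagliardoMeasure, withDensity_apply _ ht, withDensity_apply _ ht]
    exact lintegral_mono'
      (Measure.restrict_mono_measure (Measure.restrict_mono (prod_mono hAB hAB) le_rfl) t) le_rfl)
    le_rfl

theorem modular_zero (s : ℝ) (A : Set (E N)) : modular φ s A 0 = 0 := by
  simp [modular, Ds, Phi]

theorem IsAdmissible.modularHat_convex (h : IsAdmissible φ) {u v : E N → ℝ}
    (hu : AEMeasurable u volume) {c d : ℝ} (hc : 0 ≤ c) (hd : 0 ≤ d) (hcd : c + d = 1) :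
    modularHat φ univ (c • u + d • v) ≤
      ENNReal.ofReal c * modularHat φ univ u + ENNReal.ofReal d * modularHat φ univ v := by
  unfold modularHat
  rw [Measure.restrict_univ]
  have hm : AEMeasurable (fun x : E N => ENNReal.ofReal (Phi φ x x (u x))) volume :=
    (aemeasurable_comp_of_continuous (F := fun x : E N => Phi φ x x)
      (fun x => h.Phi_continuous x x) h.aemeasurable_diag hu).ennreal_ofReal
  rw [← lintegral_const_mul' _ _ ENNReal.ofReal_ne_top,
    ← lintegral_const_mul' _ _ ENNReal.ofReal_ne_top, ← lintegral_add_left' (hm.const_mul _)]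
  refine lintegral_mono fun p => ?_
  rw [← ENNReal.ofReal_mul hc, ← ENNReal.ofReal_mul hd,
    ← ENNReal.ofReal_add (mul_nonneg hc (h.Phi_nonneg _ _ _)) (mul_nonneg hd (h.Phi_nonneg _ _ _))]
  exact ENNReal.ofReal_le_ofReal (h.Phi_convex _ _ _ _ hc hd hcd)

theorem IsAdmissible.modularHat_mono (h : IsAdmissible φ) (A : Set (E N))
    (u : E N → ℝ) {c d : ℝ} (hcd : |c| ≤ |d|) :
    modularHat φ A (c • u) ≤ modularHat φ A (d • u) := by
  refine lintegral_mono fun p => ENNReal.ofReal_le_ofReal (h.Phi_mono _ _ ?_)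
  simp only [Pi.smul_apply, smul_eq_mul, abs_mul]
  exact mul_le_mul_of_nonneg_right hcd (abs_nonneg _)

theorem exists_pos_add {M : (E N → ℝ) → ℝ≥0∞}
    (hmono : ∀ (u : E N → ℝ) {c d : ℝ}, |c| ≤ |d| → M (c • u) ≤ M (d • u))
    (hconv : ∀ {u v : E N → ℝ}, AEMeasurable u volume → ∀ {c d : ℝ}, 0 ≤ c → 0 ≤ d → c + d = 1 →
      M (c • u + d • v) ≤ ENNReal.ofReal c * M u + ENNReal.ofReal d * M v)
    {u v : E N → ℝ} (hum : AEMeasurable u volume)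
    (hu : ∃ c : ℝ, 0 < c ∧ M (c • u) < ∞) (hv : ∃ c : ℝ, 0 < c ∧ M (c • v) < ∞) :
    ∃ c : ℝ, 0 < c ∧ M (c • (u + v)) < ∞ := by
  obtain ⟨a, ha, hau⟩ := hu
  obtain ⟨b, hb, hbv⟩ := hv
  have hmin : 0 < min a b := lt_min ha hb
  refine ⟨min a b / 2, by positivity, ?_⟩
  have he : (min a b / 2) • (u + v) = (1 / 2 : ℝ) • (min a b • u) + (1 / 2 : ℝ) • (min a b • v) := by
    rw [smul_smul, smul_smul, ← smul_add]
    congr 1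
    ring
  rw [he]
  refine (hconv (hum.const_smul _) (by norm_num) (by norm_num) (by norm_num)).trans_lt ?_
  have h1 : M (min a b • u) < ∞ := (hmono u (by
    rw [abs_of_pos hmin, abs_of_pos ha]; exact min_le_left _ _)).trans_lt hau
  have h2 : M (min a b • v) < ∞ := (hmono v (by
    rw [abs_of_pos hmin, abs_of_pos hb]; exact min_le_right _ _)).trans_lt hbv
  exact ENNReal.add_lt_top.2 ⟨ENNReal.mul_lt_top ENNReal.ofReal_lt_top h1,
    ENNReal.mul_lt_top ENNReal.ofReal_lt_top h2⟩

theorem exists_pos_smul {M : (E N → ℝ) → ℝ≥0∞} (h0 : M 0 = 0) {u : E N → ℝ} (k : ℝ)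
    (hmono : ∀ (u : E N → ℝ) {c d : ℝ}, |c| ≤ |d| → M (c • u) ≤ M (d • u))
    (hu : ∃ c : ℝ, 0 < c ∧ M (c • u) < ∞) : ∃ c : ℝ, 0 < c ∧ M (c • (k • u)) < ∞ := by
  obtain ⟨a, ha, hau⟩ := hu
  rcases eq_or_ne k 0 with rfl | hk
  · exact ⟨1, one_pos, by simp [h0]⟩
  · have hk' : 0 < |k| := abs_pos.2 hk
    refine ⟨a / |k|, by positivity, ?_⟩
    rw [smul_smul]
    refine (hmono u ?_).trans_lt hau
    rw [abs_mul, abs_div, abs_abs, div_mul_cancel₀ _ hk'.ne']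

end Aux

/-- `{u ∈ W^{s,Φ_{x,y}}(ℝ^N) : u = 0 a.e. in ℝ^N \ Ω}` as a linear space of functions. -/
def W0Submodule {N : ℕ} {φ : E N → E N → ℝ → ℝ} (hφ : IsAdmissible φ) (s : ℝ) (Ω : Set (E N)) :
    Submodule ℝ (E N → ℝ) where
  carrier := {u | MemW φ s univ u ∧ ∀ᵐ x ∂(volume : Measure (E N)), x ∉ Ω → u x = 0}
  zero_mem' := by
    refine ⟨⟨measurable_const.aemeasurable, ⟨1, one_pos, ?_⟩, ⟨1, one_pos, ?_⟩⟩, by simp⟩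
    · simp [modularHat, Phi]
    · simp [modular_zero]
  add_mem' := by
    rintro u v ⟨⟨hu1, hu2, hu3⟩, hu4⟩ ⟨⟨hv1, hv2, hv3⟩, hv4⟩
    have hum : AEMeasurable u volume := by rwa [Measure.restrict_univ] at hu1
    refine ⟨⟨hu1.add hv1, ?_, ?_⟩, ?_⟩
    · exact exists_pos_add (fun u _ _ h => hφ.modularHat_mono univ u h)
        (fun h _ _ hc hd hcd => hφ.modularHat_convex h hc hd hcd) hum hu2 hv2
    · exact exists_pos_add (fun u _ _ h => hφ.modular_mono s univ u h)
        (fun h _ _ hc hd hcd => hφ.modular_convex s univ h hc hd hcd) hum hu3 hv3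
    · filter_upwards [hu4, hv4] with x h1 h2 hx
      simp [h1 hx, h2 hx]
  smul_mem' := by
    rintro k u ⟨⟨hu1, hu2, hu3⟩, hu4⟩
    refine ⟨⟨hu1.const_smul k, ?_, ?_⟩, ?_⟩
    · exact exists_pos_smul (by simp [modularHat, Phi]) k
        (fun u _ _ h => hφ.modularHat_mono univ u h) hu2
    · exact exists_pos_smul (modular_zero s univ) k
        (fun u _ _ h => hφ.modular_mono s univ u h) hu3
    · filter_upwards [hu4] with x h1 hx
      simp [h1 hx]

/-- The space `W_0^{s,Φ_{x,y}}(Ω)`. Functions are not identified when they agree almost everywhere: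
such functions have distance `0`. -/
def W0 {N : ℕ} {φ : E N → E N → ℝ → ℝ} (hφ : IsAdmissible φ) (s : ℝ) (Ω : Set (E N)) : Type :=
  W0Submodule hφ s Ω

section W0

variable {N : ℕ} {φ : E N → E N → ℝ → ℝ} {hφ : IsAdmissible φ} {s : ℝ} {Ω : Set (E N)}

instance : AddCommGroup (W0 hφ s Ω) := inferInstanceAs (AddCommGroup (W0Submodule hφ s Ω))

instance : Module ℝ (W0 hφ s Ω) := inferInstanceAs (Module ℝ (W0Submodule hφ s Ω))

/-- The underlying function of an element of `W_0^{s,Φ_{x,y}}(Ω)`. -/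
def W0.toFun (u : W0 hφ s Ω) : E N → ℝ := u.1

theorem W0.toFun_add (u v : W0 hφ s Ω) : (u + v).toFun = u.toFun + v.toFun := rfl

theorem W0.toFun_smul (c : ℝ) (u : W0 hφ s Ω) : (c • u).toFun = c • u.toFun := rfl

theorem W0.aemeasurable (u : W0 hφ s Ω) : AEMeasurable u.toFun volume := by
  have := u.2.1.1
  rwa [Measure.restrict_univ] at this

/-- The norm `‖u‖ = [u]_{s,Φ_{x,y}}` of `W_0^{s,Φ_{x,y}}(Ω)`. -/
instance : Norm (W0 hφ s Ω) := ⟨fun u => gagliardoSeminorm φ s Ω u.toFun⟩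

theorem W0.norm_def (u : W0 hφ s Ω) : ‖u‖ = gagliardoSeminorm φ s Ω u.toFun := rfl

theorem gagliardoSeminorm_nonneg (A : Set (E N)) (u : E N → ℝ) :
    0 ≤ gagliardoSeminorm φ s A u := Real.sInf_nonneg fun _ hc => hc.1.le

theorem gagliardoSeminorm_bddBelow (A : Set (E N)) (u : E N → ℝ) :
    BddBelow {c : ℝ | 0 < c ∧ modular φ s A (c⁻¹ • u) ≤ 1} := ⟨0, fun _ hc => hc.1.le⟩

theorem W0.set_nonempty (u : W0 hφ s Ω) :
    {c : ℝ | 0 < c ∧ modular φ s Ω (c⁻¹ • u.toFun) ≤ 1}.Nonempty := by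
  obtain ⟨a, ha, hau⟩ := u.2.1.2.2
  have hfin : modular φ s Ω (a • u.toFun) < ∞ :=
    (modular_mono_set s (subset_univ Ω) _).trans_lt hau
  set K := (modular φ s Ω (a • u.toFun)).toReal with hK
  have hK0 : 0 ≤ K := ENNReal.toReal_nonneg
  refine ⟨(K + 1) / a, by positivity, ?_⟩
  have hd : 1 / (K + 1) + K / (K + 1) = 1 := by field_simp; ring
  have he : ((K + 1) / a)⁻¹ • u.toFun
      = (1 / (K + 1)) • (a • u.toFun) + (K / (K + 1)) • (0 : E N → ℝ) := by
    rw [smul_smul, smul_zero, add_zero]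
    congr 1
    field_simp
  rw [he]
  refine (hφ.modular_convex s Ω (u.aemeasurable.const_smul a) (by positivity) (by positivity)
    hd).trans ?_
  rw [modular_zero, mul_zero, add_zero, ← ENNReal.ofReal_toReal hfin.ne, ← hK,
    ← ENNReal.ofReal_mul (by positivity), ← ENNReal.ofReal_one]
  apply ENNReal.ofReal_le_ofReal
  rw [one_div, inv_mul_le_iff₀ (by positivity)]
  linarith

theorem W0.norm_add_le' (u v : W0 hφ s Ω) : ‖u + v‖ ≤ ‖u‖ + ‖v‖ := by
  refine le_of_forall_pos_lt_add fun ε hε => ?_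
  obtain ⟨a, ⟨ha, hau⟩, hal⟩ := exists_lt_of_csInf_lt u.set_nonempty
    (show gagliardoSeminorm φ s Ω u.toFun < ‖u‖ + ε / 2 by rw [W0.norm_def]; linarith)
  obtain ⟨b, ⟨hb, hbv⟩, hbl⟩ := exists_lt_of_csInf_lt v.set_nonempty
    (show gagliardoSeminorm φ s Ω v.toFun < ‖v‖ + ε / 2 by rw [W0.norm_def]; linarith)
  have hle : ‖u + v‖ ≤ a + b := by
    refine csInf_le (gagliardoSeminorm_bddBelow Ω _) ⟨by positivity, ?_⟩
    have hd : a / (a + b) + b / (a + b) = 1 := by field_simp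
    have he : (a + b)⁻¹ • (u + v).toFun
        = (a / (a + b)) • (a⁻¹ • u.toFun) + (b / (a + b)) • (b⁻¹ • v.toFun) := by
      rw [W0.toFun_add, smul_smul, smul_smul, smul_add]
      congr 2 <;> field_simp
    rw [he]
    refine (hφ.modular_convex s Ω (u.aemeasurable.const_smul _) (by positivity) (by positivity)
      hd).trans ?_
    calc _ ≤ ENNReal.ofReal (a / (a + b)) * 1 + ENNReal.ofReal (b / (a + b)) * 1 := by gcongr
      _ = 1 := by
        rw [mul_one, mul_one, ← ENNReal.ofReal_add (by positivity) (by positivity), hd,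
          ENNReal.ofReal_one]
  linarith

theorem W0.norm_smul_le' (c : ℝ) (u : W0 hφ s Ω) : ‖c • u‖ ≤ |c| * ‖u‖ := by
  rcases eq_or_ne c 0 with rfl | hc
  · rw [zero_smul, abs_zero, zero_mul]
    refine le_of_forall_pos_le_add fun ε hε => ?_
    refine csInf_le (gagliardoSeminorm_bddBelow Ω _) ⟨by linarith, ?_⟩
    have : (0 : W0 hφ s Ω).toFun = 0 := rfl
    rw [this, smul_zero, modular_zero]
    exact zero_le_one
  · have hc' : 0 < |c| := abs_pos.2 hc
    rw [← div_le_iff₀' hc']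
    refine le_csInf u.set_nonempty ?_
    rintro a ⟨ha, hau⟩
    rw [div_le_iff₀' hc']
    refine csInf_le (gagliardoSeminorm_bddBelow Ω _) ⟨by positivity, ?_⟩
    refine le_trans ?_ hau
    rw [W0.toFun_smul, smul_smul]
    apply hφ.modular_mono
    rw [mul_inv, abs_mul, abs_mul, abs_inv, abs_inv, abs_abs]
    field_simp
    exact le_rfl

theorem W0.seminormedCore : SeminormedSpace.Core ℝ (W0 hφ s Ω) where
  norm_nonneg u := gagliardoSeminorm_nonneg Ω _
  norm_smul c u := by
    refine le_antisymm (W0.norm_smul_le' c u) ?_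
    rcases eq_or_ne c 0 with rfl | hc
    · rw [norm_zero, zero_mul]
      exact gagliardoSeminorm_nonneg Ω _
    · have h1 := W0.norm_smul_le' c⁻¹ (c • u)
      rw [smul_smul, inv_mul_cancel₀ hc, one_smul, abs_inv] at h1
      rwa [Real.norm_eq_abs, ← le_inv_mul_iff₀ (abs_pos.2 hc)]
  norm_triangle := W0.norm_add_le'

instance : SeminormedAddCommGroup (W0 hφ s Ω) := SeminormedAddCommGroup.ofCore W0.seminormedCore

instance : NormedSpace ℝ (W0 hφ s Ω) where
  norm_smul_le c u := (W0.seminormedCore.norm_smul c u).le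

/-- The Gagliardo modular `J_{s,Φ} : W_0^{s,Φ_{x,y}}(Ω) → ℝ`,
`J_{s,Φ}(u) = ∫_Ω ∫_Ω Φ_{x,y}(D_s u(x,y)) dμ`. -/
def J (u : W0 hφ s Ω) : ℝ := (modular φ s Ω u.toFun).toReal

end W0

/-- `A : X → X*` is the Gâteaux derivative of `F : X → ℝ`. -/
def IsGateauxDeriv {X : Type*} [SeminormedAddCommGroup X] [NormedSpace ℝ X] (F : X → ℝ)
    (A : X → StrongDual ℝ X) : Prop :=
  ∀ u v : X, HasLineDerivAt ℝ F (A u v) u v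

/-- The `(S₊)`-property of `A : X → X*`: if `u_n ⇀ u` weakly and
`limsup ⟨A u_n, u_n - u⟩ ≤ 0` (in `[-∞,∞]`), then `u_n → u` strongly. -/
def HasSPlus {X : Type*} [SeminormedAddCommGroup X] [NormedSpace ℝ X]
    (A : X → StrongDual ℝ X) : Prop :=
  ∀ (u : ℕ → X) (u₀ : X),
    (∀ f : StrongDual ℝ X, Tendsto (fun n => f (u n)) atTop (𝓝 (f u₀))) →
    limsup (fun n => ((A (u n) (u n - u₀) : ℝ) : EReal)) atTop ≤ 0 →
    Tendsto u atTop (𝓝 u₀)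

end FracMusielak

end

noncomputable section

namespace FracMusielak

section Pointwise

variable {N : ℕ} {φ : E N → E N → ℝ → ℝ}

theorem IsAdmissible.continuous_odd_extension (h : IsAdmissible φ) (x y : E N) :
    Continuous (fun t : ℝ => t * φ x y |t|) := by
  refine continuous_iff_continuousAt.2 fun t => ?_
  rcases eq_or_ne t 0 with rfl | ht
  · rw [continuousAt_iff_punctured_nhds, zero_mul, tendsto_zero_iff_norm_tendsto_zero]
    have h1 : Tendsto (fun t : ℝ => |t|) (𝓝[≠] 0) (𝓝[>] 0) := by
      refine tendsto_nhdsWithin_iff.2 ⟨?_, ?_⟩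
      · simpa using (continuous_abs.tendsto (0 : ℝ)).mono_left nhdsWithin_le_nhds
      · filter_upwards [self_mem_nhdsWithin] with t ht using abs_pos.2 ht
    refine ((h.tendsto_zero x y).comp h1).congr' ?_
    filter_upwards [self_mem_nhdsWithin] with t ht
    simp [abs_of_nonneg (h.nonneg x y |t| (abs_pos.2 ht))]
  · have h1 : ContinuousAt (φ x y) |t| :=
      (h.continuousOn x y).continuousAt (Ioi_mem_nhds (abs_pos.2 ht))
    exact continuousAt_id.mul (h1.comp continuous_abs.continuousAt)

theorem Phi_eq_integral (x y : E N) (t : ℝ) :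
    Phi φ x y t = ∫ τ in (0 : ℝ)..t, τ * φ x y |τ| := by
  have key : ∀ r : ℝ, 0 ≤ r → ∫ τ in (0 : ℝ)..r, τ * φ x y τ = ∫ τ in (0 : ℝ)..r, τ * φ x y |τ| := by
    intro r hr
    refine intervalIntegral.integral_congr fun τ hτ => ?_
    rw [uIcc_of_le hr] at hτ
    simp [abs_of_nonneg hτ.1]
  rw [Phi, key _ (abs_nonneg t)]
  rcases le_total 0 t with ht | ht
  · rw [abs_of_nonneg ht]
  · rw [abs_of_nonpos ht]
    have h1 := intervalIntegral.integral_comp_neg (a := t) (b := 0)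
      (fun τ : ℝ => τ * φ x y |τ|)
    simp only [abs_neg, neg_mul, neg_zero, intervalIntegral.integral_neg] at h1
    rw [← h1, intervalIntegral.integral_symm, neg_neg]

theorem IsAdmissible.hasDerivAt_Phi (h : IsAdmissible φ) (x y : E N) (t : ℝ) :
    HasDerivAt (Phi φ x y) (t * φ x y |t|) t := by
  have : Phi φ x y = fun t => ∫ τ in (0 : ℝ)..t, τ * φ x y |τ| := funext (Phi_eq_integral x y)
  rw [this]
  exact ((h.continuous_odd_extension x y).integral_hasStrictDerivAt 0 t).hasDerivAt

theorem IsAdmissible.Phi_tangent (h : IsAdmissible φ) (x y : E N) (a b : ℝ) :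
    a * φ x y |a| * b ≤ Phi φ x y (a + b) - Phi φ x y a := by
  have hc : ConvexOn ℝ univ (Phi φ x y) :=
    ⟨convex_univ, fun a _ b _ c d hc hd hcd => h.Phi_convex x y a b hc hd hcd⟩
  rcases lt_trichotomy b 0 with hb | rfl | hb
  · have := hc.slope_le_of_hasDerivAt (mem_univ (a + b)) (mem_univ a) (by linarith)
      (h.hasDerivAt_Phi x y a)
    rw [slope_def_field, div_le_iff₀ (by linarith)] at this
    nlinarith
  · simp
  · have := hc.le_slope_of_hasDerivAt (mem_univ a) (mem_univ (a + b)) (by linarith)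
      (h.hasDerivAt_Phi x y a)
    rw [slope_def_field, le_div_iff₀ (by linarith)] at this
    nlinarith

theorem IsAdmissible.abs_deriv_mul_le (h : IsAdmissible φ) (x y : E N) (a b : ℝ) :
    |a * φ x y |a| * b| ≤ Phi φ x y (|a| + |b|) := by
  have h1 := h.Phi_tangent x y a b
  have h2 := h.Phi_tangent x y a (-b)
  have h0 := h.Phi_nonneg x y a
  have h3 : Phi φ x y (a + b) ≤ Phi φ x y (|a| + |b|) :=
    h.Phi_mono x y ((abs_add_le a b).trans (le_abs_self _))
  have h4 : Phi φ x y (a + -b) ≤ Phi φ x y (|a| + |b|) :=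
    h.Phi_mono x y (((abs_add_le a (-b)).trans (by rw [abs_neg])).trans (le_abs_self _))
  rw [abs_le]
  constructor <;> linarith

theorem IsAdmissible.Phi_abs_add_le (h : IsAdmissible φ) (x y : E N) (a b : ℝ) :
    Phi φ x y (|a| + |b|) ≤ Phi φ x y (2 * a) + Phi φ x y (2 * b) := by
  have h1 := h.Phi_convex x y (2 * |a|) (2 * |b|) (c := 1 / 2) (d := 1 / 2)
    (by norm_num) (by norm_num) (by norm_num)
  have h2 : ∀ a : ℝ, Phi φ x y (2 * |a|) = Phi φ x y (2 * a) := fun a => by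
    rw [← Phi_abs x y (2 * a), abs_mul, abs_of_pos (two_pos (α := ℝ))]
  rw [h2, h2] at h1
  have h3 := h.Phi_nonneg x y (2 * a)
  have h4 := h.Phi_nonneg x y (2 * b)
  have h5 : (1 / 2 : ℝ) * (2 * |a|) + 1 / 2 * (2 * |b|) = |a| + |b| := by ring
  rw [h5] at h1
  linarith

/-- The `Δ₂`-condition, uniformly in `x`, `y`. -/
theorem IsAdmissible.exists_Phi_mul_le (h : IsAdmissible φ) (k : ℝ) :
    ∃ C : ℝ, 0 < C ∧ ∀ x y t, Phi φ x y (k * t) ≤ C * Phi φ x y t := by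
  obtain ⟨l, m, hl, hlm, hg⟩ := h.growth
  have hm : 0 < m := by linarith
  set δ : ℝ := 1 + 1 / (2 * m) with hδ
  have hδ1 : 1 < δ := by rw [hδ]; have : 0 < 1 / (2 * m) := by positivity
                         linarith
  have hm' : ∀ x y t, 0 < t → t ^ 2 * φ x y t ≤ m * Phi φ x y t := by
    intro x y t ht
    have hpos : 0 < Phi φ x y t := by
      refine lt_of_le_of_ne (h.Phi_nonneg x y t) fun h0 => ?_
      have := (hg x y t ht).1
      rw [← h0, div_zero] at this
      linarith
    exact (div_le_iff₀ hpos).1 (hg x y t ht).2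
  have hstep : ∀ x y t, 0 ≤ t → Phi φ x y (δ * t) ≤ 2 * Phi φ x y t := by
    intro x y t ht
    rcases eq_or_lt_of_le ht with rfl | ht
    · simp [Phi_zero]
    · have hpos : 0 < δ * t := by positivity
      have h1 := h.Phi_tangent x y (δ * t) (t - δ * t)
      have h2 := hm' x y (δ * t) hpos
      rw [abs_of_pos hpos, show δ * t + (t - δ * t) = t by ring] at h1
      have h3 : δ * t * φ x y (δ * t) * (δ * t - t) ≤ 1 / 2 * Phi φ x y (δ * t) := by
        have hnn := h.nonneg x y _ hpos
        calc δ * t * φ x y (δ * t) * (δ * t - t)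
            = (1 / (2 * m)) * (δ * t * t * φ x y (δ * t)) := by rw [hδ]; ring
          _ ≤ (1 / (2 * m)) * ((δ * t) ^ 2 * φ x y (δ * t)) := by
            have : t ≤ δ * t := by nlinarith
            have h6 : δ * t * t ≤ (δ * t) ^ 2 := by nlinarith
            gcongr
          _ ≤ (1 / (2 * m)) * (m * Phi φ x y (δ * t)) := by gcongr
          _ = 1 / 2 * Phi φ x y (δ * t) := by field_simp
      linarith
  obtain ⟨n, hn⟩ := pow_unbounded_of_one_lt |k| hδ1
  refine ⟨2 ^ n, by positivity, fun x y t => ?_⟩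
  have hiter : ∀ n : ℕ, Phi φ x y (δ ^ n * |t|) ≤ 2 ^ n * Phi φ x y |t| := by
    intro n
    induction n with
    | zero => simp
    | succ n ih =>
      calc Phi φ x y (δ ^ (n + 1) * |t|) = Phi φ x y (δ * (δ ^ n * |t|)) := by ring_nf
        _ ≤ 2 * Phi φ x y (δ ^ n * |t|) := hstep _ _ _ (by positivity)
        _ ≤ 2 * (2 ^ n * Phi φ x y |t|) := by gcongr
        _ = 2 ^ (n + 1) * Phi φ x y |t| := by ring
  have h1 := hiter n
  rw [Phi_abs] at h1
  refine (h.Phi_mono x y ?_).trans h1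
  rw [abs_mul, abs_of_nonneg (show 0 ≤ δ ^ n * |t| by positivity)]
  gcongr

theorem IsAdmissible.exists_modular_smul_le (h : IsAdmissible φ) (s : ℝ) (A : Set (E N)) (k : ℝ) :
    ∃ C : ℝ, 0 < C ∧ ∀ u : E N → ℝ, modular φ s A (k • u) ≤ ENNReal.ofReal C * modular φ s A u := by
  obtain ⟨C, hC, hk⟩ := h.exists_Phi_mul_le k
  refine ⟨C, hC, fun u => ?_⟩
  unfold modular
  rw [← lintegral_const_mul' _ _ ENNReal.ofReal_ne_top]
  refine lintegral_mono fun p => ?_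
  rw [← ENNReal.ofReal_mul hC.le, Ds_smul]
  exact ENNReal.ofReal_le_ofReal (hk _ _ _)

/-- A linear lower bound for `Φ_{x,y}`. -/
theorem IsAdmissible.abs_le_one_add_Phi (h : IsAdmissible φ) {x y : E N} {c : ℝ} (hc : 0 < c)
    (hcx : c ≤ Phi φ x y 1) (t : ℝ) : |t| ≤ 1 + c⁻¹ * Phi φ x y t := by
  rcases le_total |t| 1 with ht | ht
  · have := h.Phi_nonneg x y t
    have : 0 ≤ c⁻¹ * Phi φ x y t := by positivity
    linarith
  · have ht0 : 0 < |t| := by linarith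
    have h1 := h.Phi_convex x y |t| 0 (c := |t|⁻¹) (d := 1 - |t|⁻¹) (by positivity)
      (by have := inv_le_one_of_one_le₀ ht; linarith) (by ring)
    rw [mul_zero, add_zero, inv_mul_cancel₀ ht0.ne', Phi_zero, mul_zero, add_zero, Phi_abs] at h1
    have h2 : c * |t| ≤ Phi φ x y t := by
      have := hcx.trans h1
      rwa [le_inv_mul_iff₀ ht0, mul_comm] at this
    have : |t| ≤ c⁻¹ * Phi φ x y t := by rwa [le_inv_mul_iff₀ hc]
    linarith

end Pointwise

section Derivative

variable {N : ℕ} {φ : E N → E N → ℝ → ℝ} {hφ : IsAdmissible φ} {s : ℝ} {Ω : Set (E N)}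

theorem W0.modular_lt_top (u : W0 hφ s Ω) : modular φ s Ω u.toFun < ∞ := by
  obtain ⟨a, ha, hau⟩ := u.2.1.2.2
  obtain ⟨C, -, h⟩ := hφ.exists_modular_smul_le s Ω a⁻¹
  have h1 := h (a • u.toFun)
  rw [smul_smul, inv_mul_cancel₀ ha.ne', one_smul] at h1
  exact h1.trans_lt (ENNReal.mul_lt_top ENNReal.ofReal_lt_top
    ((modular_mono_set s (subset_univ Ω) _).trans_lt hau))

theorem W0.aestronglyMeasurable_Phi (u : W0 hφ s Ω) :
    AEStronglyMeasurable (fun p => Phi φ p.1 p.2 (Ds s u.toFun p)) (gagliardoMeasure Ω) :=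
  ((aemeasurable_comp_of_continuous (F := fun p : E N × E N => Phi φ p.1 p.2)
    (fun p => hφ.Phi_continuous p.1 p.2) hφ.aemeasurable
    (aemeasurable_Ds s u.aemeasurable)).mono_ac (gagliardoMeasure_ac Ω)).aestronglyMeasurable

theorem W0.integrable_Phi (u : W0 hφ s Ω) :
    Integrable (fun p => Phi φ p.1 p.2 (Ds s u.toFun p)) (gagliardoMeasure Ω) :=
  ⟨u.aestronglyMeasurable_Phi, (hasFiniteIntegral_iff_ofReal
    (ae_of_all _ fun _ => hφ.Phi_nonneg _ _ _)).2 u.modular_lt_top⟩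

theorem J_eq_integral (u : W0 hφ s Ω) :
    J u = ∫ p, Phi φ p.1 p.2 (Ds s u.toFun p) ∂(gagliardoMeasure Ω) :=
  (integral_eq_lintegral_of_nonneg_ae (ae_of_all _ fun _ => hφ.Phi_nonneg _ _ _)
    u.aestronglyMeasurable_Phi).symm

/-- The density `D_s u φ_{x,y}(|D_s u|) D_s v` of the derivative of the Gagliardo modular. -/
def derivIntegrand (u v : W0 hφ s Ω) (p : E N × E N) : ℝ :=
  Ds s u.toFun p * φ p.1 p.2 |Ds s u.toFun p| * Ds s v.toFun p

theorem Ds_toFun_add (u v : W0 hφ s Ω) (p : E N × E N) :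
    Ds s (u + v).toFun p = Ds s u.toFun p + Ds s v.toFun p := by rw [W0.toFun_add, Ds_add]

theorem Ds_toFun_smul (c : ℝ) (u : W0 hφ s Ω) (p : E N × E N) :
    Ds s (c • u).toFun p = c * Ds s u.toFun p := by rw [W0.toFun_smul, Ds_smul]

theorem Ds_toFun_sub (u v : W0 hφ s Ω) (p : E N × E N) :
    Ds s (u - v).toFun p = Ds s u.toFun p - Ds s v.toFun p := by
  rw [sub_eq_add_neg, ← neg_one_smul ℝ v, Ds_toFun_add, Ds_toFun_smul]; ring

theorem hasDerivAt_Phi_Ds (u v : W0 hφ s Ω) (p : E N × E N) (t : ℝ) :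
    HasDerivAt (fun t : ℝ => Phi φ p.1 p.2 (Ds s (u + t • v).toFun p))
      (derivIntegrand (u + t • v) v p) t := by
  have h1 : HasDerivAt (fun t : ℝ => Ds s (u + t • v).toFun p) (Ds s v.toFun p) t := by
    simp only [Ds_toFun_add, Ds_toFun_smul]
    simpa using ((hasDerivAt_id t).mul_const (Ds s v.toFun p)).const_add (Ds s u.toFun p)
  exact (hφ.hasDerivAt_Phi p.1 p.2 _).comp t h1

theorem aestronglyMeasurable_derivIntegrand (u v : W0 hφ s Ω) :
    AEStronglyMeasurable (derivIntegrand u v) (gagliardoMeasure Ω) := by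
  have hlim : ∀ p, Tendsto (fun n : ℕ => ((n : ℝ) + 1) *
      (Phi φ p.1 p.2 (Ds s (u + (1 / ((n : ℝ) + 1)) • v).toFun p)
        - Phi φ p.1 p.2 (Ds s u.toFun p))) atTop (𝓝 (derivIntegrand u v p)) := by
    intro p
    have h1 := (hasDerivAt_Phi_Ds u v p 0).tendsto_slope_zero
    have h2 : Tendsto (fun n : ℕ => 1 / ((n : ℝ) + 1)) atTop (𝓝[≠] 0) :=
      tendsto_nhdsWithin_iff.2 ⟨tendsto_one_div_add_atTop_nhds_zero_nat,
        Eventually.of_forall fun n => by simp; positivity⟩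
    have h3 := h1.comp h2
    simp only [zero_smul, add_zero, zero_add] at h3
    refine h3.congr fun n => ?_
    simp [smul_eq_mul]
  refine aestronglyMeasurable_of_tendsto_ae atTop (fun n => ?_) (ae_of_all _ hlim)
  exact ((W0.aestronglyMeasurable_Phi _).sub u.aestronglyMeasurable_Phi).const_mul _

theorem abs_derivIntegrand_le (u v : W0 hφ s Ω) (p : E N × E N) :
    |derivIntegrand u v p| ≤ Phi φ p.1 p.2 (Ds s ((2 : ℝ) • u).toFun p)
      + Phi φ p.1 p.2 (Ds s ((2 : ℝ) • v).toFun p) := by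
  rw [Ds_toFun_smul, Ds_toFun_smul]
  exact (hφ.abs_deriv_mul_le _ _ _ _).trans (hφ.Phi_abs_add_le _ _ _ _)

theorem integrable_derivIntegrand (u v : W0 hφ s Ω) :
    Integrable (derivIntegrand u v) (gagliardoMeasure Ω) :=
  (((2 : ℝ) • u).integrable_Phi.add ((2 : ℝ) • v).integrable_Phi).mono'
    (aestronglyMeasurable_derivIntegrand u v) (ae_of_all _ (abs_derivIntegrand_le u v))

theorem hasLineDerivAt_J (u v : W0 hφ s Ω) :
    HasLineDerivAt ℝ (J (hφ := hφ) (s := s) (Ω := Ω))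
      (∫ p, derivIntegrand u v p ∂(gagliardoMeasure Ω)) u v := by
  unfold HasLineDerivAt
  simp only [J_eq_integral]
  have h := hasDerivAt_integral_of_dominated_loc_of_deriv_le (μ := gagliardoMeasure Ω)
    (F := fun (t : ℝ) p => Phi φ p.1 p.2 (Ds s (u + t • v).toFun p))
    (F' := fun (t : ℝ) p => derivIntegrand (u + t • v) v p) (x₀ := (0 : ℝ))
    (bound := fun p => Phi φ p.1 p.2 (Ds s ((2 : ℝ) • u).toFun p)
      + Phi φ p.1 p.2 (Ds s ((4 : ℝ) • v).toFun p))
    (Metric.ball_mem_nhds 0 one_pos)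
    (Eventually.of_forall fun t => W0.aestronglyMeasurable_Phi _)
    (W0.integrable_Phi _) (aestronglyMeasurable_derivIntegrand _ _) ?_
    (W0.integrable_Phi _ |>.add (W0.integrable_Phi _))
    (ae_of_all _ fun p t _ => hasDerivAt_Phi_Ds u v p t)
  · simpa using h.2
  · refine ae_of_all _ fun p t ht => ?_
    rw [mem_ball_zero_iff, Real.norm_eq_abs] at ht
    refine (hφ.abs_deriv_mul_le _ _ _ _).trans ?_
    rw [Ds_toFun_smul, Ds_toFun_smul, show (4 : ℝ) * Ds s v.toFun p = 2 * (2 * Ds s v.toFun p) by ring]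
    refine le_trans (hφ.Phi_mono _ _ ?_) (hφ.Phi_abs_add_le _ _ _ _)
    rw [Ds_toFun_add, Ds_toFun_smul]
    generalize Ds s u.toFun p = a
    generalize Ds s v.toFun p = b
    rw [abs_of_nonneg (show 0 ≤ |a + t * b| + |b| by positivity),
      abs_of_nonneg (show 0 ≤ |a| + |2 * b| by positivity), abs_mul, abs_of_pos (two_pos (α := ℝ))]
    have h1 := abs_add_le a (t * b)
    rw [abs_mul] at h1
    have h2 : |t| * |b| ≤ 1 * |b| := by gcongr
    linarith

theorem W0.modular_inv_smul_le_one (u : W0 hφ s Ω) {c : ℝ} (hc : ‖u‖ < c) :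
    modular φ s Ω (c⁻¹ • u.toFun) ≤ 1 := by
  obtain ⟨a, ⟨ha, hau⟩, hac⟩ := exists_lt_of_csInf_lt u.set_nonempty hc
  refine (hφ.modular_mono s Ω u.toFun ?_).trans hau
  rw [abs_of_pos (inv_pos.2 (ha.trans hac)), abs_of_pos (inv_pos.2 ha)]
  exact inv_anti₀ ha hac.le

theorem W0.norm_le_of_modular_le_one (u : W0 hφ s Ω) {c : ℝ} (hc : 0 < c)
    (h : modular φ s Ω (c⁻¹ • u.toFun) ≤ 1) : ‖u‖ ≤ c :=
  csInf_le (gagliardoSeminorm_bddBelow Ω _) ⟨hc, h⟩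

/-- A linear functional that is bounded on functions of modular at most one is bounded by
the norm. -/
theorem W0.le_mul_norm_of_modular {F : W0 hφ s Ω → ℝ} {K : ℝ}
    (hF : ∀ (c : ℝ) (u : W0 hφ s Ω), 0 < c → F (c • u) = c * F u)
    (hK : ∀ u : W0 hφ s Ω, modular φ s Ω u.toFun ≤ 1 → F u ≤ K) (u : W0 hφ s Ω) :
    F u ≤ K * ‖u‖ := by
  have key : ∀ c : ℝ, ‖u‖ < c → F u ≤ K * c := by
    intro c hc
    have hc0 : 0 < c := (norm_nonneg u).trans_lt hc
    have h1 := hK (c⁻¹ • u) (by rw [W0.toFun_smul]; exact u.modular_inv_smul_le_one hc)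
    rwa [hF _ _ (inv_pos.2 hc0), inv_mul_le_iff₀ hc0, mul_comm] at h1
  have h2 : Tendsto (fun c : ℝ => K * c) (𝓝[>] ‖u‖) (𝓝 (K * ‖u‖)) :=
    ((continuous_const.mul continuous_id).tendsto _).mono_left nhdsWithin_le_nhds
  exact ge_of_tendsto h2 (by filter_upwards [self_mem_nhdsWithin] with c hc using key c hc)

theorem integral_derivIntegrand_smul (u v : W0 hφ s Ω) (c : ℝ) :
    ∫ p, derivIntegrand u (c • v) p ∂(gagliardoMeasure Ω)
      = c * ∫ p, derivIntegrand u v p ∂(gagliardoMeasure Ω) := by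
  rw [← integral_const_mul]
  congr 1
  funext p
  simp only [derivIntegrand, Ds_toFun_smul]
  ring

theorem exists_abs_integral_derivIntegrand_le (u : W0 hφ s Ω) :
    ∃ K : ℝ, ∀ v : W0 hφ s Ω, |∫ p, derivIntegrand u v p ∂(gagliardoMeasure Ω)| ≤ K * ‖v‖ := by
  obtain ⟨C, hC, h2⟩ := hφ.exists_modular_smul_le s Ω 2
  refine ⟨J ((2 : ℝ) • u) + C, W0.le_mul_norm_of_modular (fun c v hc => ?_) fun v hv => ?_⟩
  · rw [integral_derivIntegrand_smul, abs_mul, abs_of_pos hc]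
  · have hJ : J ((2 : ℝ) • v) ≤ C := by
      refine ENNReal.toReal_le_of_le_ofReal hC.le ?_
      rw [W0.toFun_smul]
      exact (h2 _).trans (mul_le_of_le_one_right' hv)
    calc |∫ p, derivIntegrand u v p ∂(gagliardoMeasure Ω)|
        ≤ ∫ p, |derivIntegrand u v p| ∂(gagliardoMeasure Ω) := abs_integral_le_integral_abs
      _ ≤ J ((2 : ℝ) • u) + J ((2 : ℝ) • v) := by
        rw [J_eq_integral, J_eq_integral,
          ← integral_add (W0.integrable_Phi _) (W0.integrable_Phi _)]
        exact integral_mono (integrable_derivIntegrand u v).abs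
          ((W0.integrable_Phi _).add (W0.integrable_Phi _)) (abs_derivIntegrand_le u v)
      _ ≤ _ := by gcongr

/-- The Gâteaux derivative of the Gagliardo modular. -/
def gateauxDeriv (u : W0 hφ s Ω) : StrongDual ℝ (W0 hφ s Ω) :=
  LinearMap.mkContinuousOfExistsBound
    { toFun := fun v => ∫ p, derivIntegrand u v p ∂(gagliardoMeasure Ω)
      map_add' := fun v w => by
        rw [← integral_add (integrable_derivIntegrand u v) (integrable_derivIntegrand u w)]
        congr 1
        funext p
        simp only [derivIntegrand, Ds_toFun_add]
        ring
      map_smul' := fun c v => integral_derivIntegrand_smul u v c }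
    (exists_abs_integral_derivIntegrand_le u)

theorem gateauxDeriv_apply (u v : W0 hφ s Ω) :
    gateauxDeriv u v = ∫ p, derivIntegrand u v p ∂(gagliardoMeasure Ω) := rfl

theorem gateauxDeriv_le_sub (u v : W0 hφ s Ω) : gateauxDeriv u (v - u) ≤ J v - J u := by
  rw [gateauxDeriv_apply, J_eq_integral, J_eq_integral,
    ← integral_sub (W0.integrable_Phi _) (W0.integrable_Phi _)]
  refine integral_mono (integrable_derivIntegrand u _)
    ((W0.integrable_Phi _).sub (W0.integrable_Phi _)) fun p => ?_
  have := hφ.Phi_tangent p.1 p.2 (Ds s u.toFun p) (Ds s (v - u).toFun p)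
  rwa [← Ds_toFun_add, add_sub_cancel] at this

end Derivative

section Oscillation

variable {N : ℕ} {φ : E N → E N → ℝ → ℝ} {hφ : IsAdmissible φ} {s : ℝ} {Ω : Set (E N)}

/-- The part of `A × A` at distance less than `r` from the diagonal. -/
def nearDiag (A : Set (E N)) (r : ℝ) : Set (E N × E N) :=
  (A ×ˢ A) ∩ {p | ‖p.1 - p.2‖ < r}

theorem measurableSet_nearDiag {A : Set (E N)} (hA : MeasurableSet A) (r : ℝ) :
    MeasurableSet (nearDiag A r) :=
  (hA.prod hA).inter (measurableSet_lt (measurable_fst.sub measurable_snd).norm measurable_const)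

theorem volume_nearDiag_le {A : Set (E N)} (hA : MeasurableSet A) (r : ℝ) :
    ((volume : Measure (E N)).prod volume) (nearDiag A r)
      ≤ volume A * volume (Metric.ball (0 : E N) r) := by
  rw [Measure.prod_apply (measurableSet_nearDiag hA r)]
  calc ∫⁻ x, volume (Prod.mk x ⁻¹' nearDiag A r)
      ≤ ∫⁻ x, A.indicator (fun _ => volume (Metric.ball (0 : E N) r)) x := by
        refine lintegral_mono fun x => ?_
        by_cases hx : x ∈ A
        · rw [indicator_of_mem hx, ← Measure.addHaar_ball_center volume x r]
          refine measure_mono fun y hy => ?_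
          rw [mem_ball_iff_norm, norm_sub_rev]
          exact hy.2
        · have : Prod.mk x ⁻¹' nearDiag A r = ∅ :=
            eq_empty_of_forall_notMem fun y hy => hx hy.1.1
          simp [this]
    _ = volume A * volume (Metric.ball (0 : E N) r) := by
        rw [lintegral_indicator_const hA, mul_comm]

theorem modular_eq_lintegral (u : W0 hφ s Ω) :
    modular φ s Ω u.toFun = ∫⁻ p in Ω ×ˢ Ω, ENNReal.ofReal (1 / ‖p.1 - p.2‖ ^ N) *
      ENNReal.ofReal (Phi φ p.1 p.2 (Ds s u.toFun p)) ∂((volume : Measure (E N)).prod volume) := by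
  unfold modular gagliardoMeasure
  rw [lintegral_withDensity_eq_lintegral_mul₀]
  · rfl
  · exact (((measurable_fst.sub measurable_snd).norm.pow_const N).const_div
      1).ennreal_ofReal.aemeasurable
  · exact ((aemeasurable_comp_of_continuous (F := fun p : E N × E N => Phi φ p.1 p.2)
      (fun p => hφ.Phi_continuous p.1 p.2) hφ.aemeasurable
      (aemeasurable_Ds s u.aemeasurable)).ennreal_ofReal).restrict

theorem abs_sub_le_of_near (h : IsAdmissible φ) (hs : 0 ≤ s) {c : ℝ} (hc : 0 < c)
    (u : E N → ℝ) {p : E N × E N} (hcp : c ≤ Phi φ p.1 p.2 1) {r : ℝ} (hp : ‖p.1 - p.2‖ < r) :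
    |u p.1 - u p.2| ≤
      r ^ s + c⁻¹ * r ^ s * r ^ N * (1 / ‖p.1 - p.2‖ ^ N * Phi φ p.1 p.2 (Ds s u p)) := by
  have hr : 0 < r := (norm_nonneg _).trans_lt hp
  have hΦ := h.Phi_nonneg p.1 p.2 (Ds s u p)
  rcases eq_or_ne p.1 p.2 with he | he
  · rw [show |u p.1 - u p.2| = 0 by rw [he, sub_self, abs_zero]]
    positivity
  · have hd : 0 < ‖p.1 - p.2‖ := norm_pos_iff.2 (sub_ne_zero.2 he)
    have h1 : |u p.1 - u p.2| = |Ds s u p| * ‖p.1 - p.2‖ ^ s := by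
      have : 0 < ‖p.1 - p.2‖ ^ s := by positivity
      rw [Ds, abs_div, abs_of_pos this, div_mul_cancel₀ _ this.ne']
    have h2 : 1 ≤ r ^ N * (1 / ‖p.1 - p.2‖ ^ N) := by
      rw [mul_one_div, one_le_div (by positivity)]
      gcongr
    calc |u p.1 - u p.2| = |Ds s u p| * ‖p.1 - p.2‖ ^ s := h1
      _ ≤ (1 + c⁻¹ * Phi φ p.1 p.2 (Ds s u p)) * r ^ s := by
        gcongr
        exact h.abs_le_one_add_Phi hc hcp _
      _ = r ^ s + c⁻¹ * r ^ s * Phi φ p.1 p.2 (Ds s u p) * 1 := by ring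
      _ ≤ r ^ s + c⁻¹ * r ^ s * Phi φ p.1 p.2 (Ds s u p) * (r ^ N * (1 / ‖p.1 - p.2‖ ^ N)) := by
        gcongr
      _ = _ := by ring

theorem exists_lintegral_abs_sub_le (hΩ : IsOpen Ω) (hb : Bornology.IsBounded Ω) (hs : 0 ≤ s)
    (hB : FracBounded φ Ω) : ∃ K : ℝ, 0 ≤ K ∧ ∀ (r : ℝ), 0 < r → ∀ u : W0 hφ s Ω,
      modular φ s Ω u.toFun ≤ 1 →
      ∫⁻ p in nearDiag Ω r, ENNReal.ofReal |u.toFun p.1 - u.toFun p.2|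
        ∂((volume : Measure (E N)).prod volume) ≤ ENNReal.ofReal (K * (r ^ s * r ^ N)) := by
  obtain ⟨c, _, hc, hcΩ⟩ := hB
  set V := (volume Ω).toReal
  set B := (volume (Metric.ball (0 : E N) 1)).toReal
  refine ⟨V * B + c⁻¹, by positivity, fun r hr u hu => ?_⟩
  have hmeas := measurableSet_nearDiag hΩ.measurableSet r
  have hΦ := fun p : E N × E N => hφ.Phi_nonneg p.1 p.2 (Ds s u.toFun p)
  have hVB : volume Ω * volume (Metric.ball (0 : E N) r) = ENNReal.ofReal (V * (r ^ N * B)) := by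
    rw [Measure.addHaar_ball_of_pos volume (0 : E N) hr, finrank_euclideanSpace_fin,
      ENNReal.ofReal_mul (by positivity), ENNReal.ofReal_mul (by positivity),
      ENNReal.ofReal_toReal hb.measure_lt_top.ne, ENNReal.ofReal_toReal measure_ball_lt_top.ne]
  calc ∫⁻ p in nearDiag Ω r, ENNReal.ofReal |u.toFun p.1 - u.toFun p.2|
        ∂((volume : Measure (E N)).prod volume)
      ≤ ∫⁻ p in nearDiag Ω r, (ENNReal.ofReal (r ^ s) + ENNReal.ofReal (c⁻¹ * r ^ s * r ^ N) *
          (ENNReal.ofReal (1 / ‖p.1 - p.2‖ ^ N) *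
            ENNReal.ofReal (Phi φ p.1 p.2 (Ds s u.toFun p))))
          ∂((volume : Measure (E N)).prod volume) := by
        refine setLIntegral_mono' hmeas fun p hp => ?_
        have hΦp := hΦ p
        rw [← ENNReal.ofReal_mul (by positivity), ← ENNReal.ofReal_mul (by positivity),
          ← ENNReal.ofReal_add (by positivity) (by positivity)]
        exact ENNReal.ofReal_le_ofReal
          (abs_sub_le_of_near hφ hs hc _ (hcΩ _ hp.1.1 _ hp.1.2).1 hp.2)
    _ = ENNReal.ofReal (r ^ s) * ((volume : Measure (E N)).prod volume) (nearDiag Ω r)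
        + ENNReal.ofReal (c⁻¹ * r ^ s * r ^ N) * ∫⁻ p in nearDiag Ω r,
          (ENNReal.ofReal (1 / ‖p.1 - p.2‖ ^ N) *
            ENNReal.ofReal (Phi φ p.1 p.2 (Ds s u.toFun p)))
          ∂((volume : Measure (E N)).prod volume) := by
        rw [lintegral_add_left measurable_const, setLIntegral_const,
          lintegral_const_mul' _ _ ENNReal.ofReal_ne_top]
    _ ≤ ENNReal.ofReal (r ^ s) * ENNReal.ofReal (V * (r ^ N * B))
        + ENNReal.ofReal (c⁻¹ * r ^ s * r ^ N) * 1 := by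
        rw [← hVB]
        gcongr
        · exact volume_nearDiag_le hΩ.measurableSet r
        · refine (lintegral_mono_set inter_subset_left).trans ?_
          rwa [← modular_eq_lintegral u]
    _ = ENNReal.ofReal ((V * B + c⁻¹) * (r ^ s * r ^ N)) := by
        rw [mul_one, ← ENNReal.ofReal_mul (by positivity),
          ← ENNReal.ofReal_add (by positivity) (by positivity)]
        congr 1
        ring

theorem aestronglyMeasurable_sub_toFun (u : W0 hφ s Ω) :
    AEStronglyMeasurable (fun p : E N × E N => u.toFun p.1 - u.toFun p.2)
      ((volume : Measure (E N)).prod volume) :=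
  ((u.aemeasurable.comp_quasiMeasurePreserving Measure.quasiMeasurePreserving_fst).sub
    (u.aemeasurable.comp_quasiMeasurePreserving
      Measure.quasiMeasurePreserving_snd)).aestronglyMeasurable

theorem exists_nearDiag_eq (hb : Bornology.IsBounded Ω) :
    ∃ R : ℝ, 0 < R ∧ nearDiag Ω R = Ω ×ˢ Ω := by
  obtain ⟨C, hC⟩ := Metric.isBounded_iff.1 hb
  refine ⟨max C 0 + 1, by positivity, inter_eq_left.2 fun p hp => ?_⟩
  have h1 := hC hp.1 hp.2
  rw [dist_eq_norm] at h1
  exact (h1.trans (le_max_left _ _)).trans_lt (lt_add_one _)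

theorem integrableOn_sub_toFun (hΩ : IsOpen Ω) (hb : Bornology.IsBounded Ω) (hs : 0 ≤ s)
    (hB : FracBounded φ Ω) (u : W0 hφ s Ω) :
    IntegrableOn (fun p : E N × E N => u.toFun p.1 - u.toFun p.2) (Ω ×ˢ Ω)
      ((volume : Measure (E N)).prod volume) := by
  obtain ⟨K, -, hK⟩ := exists_lintegral_abs_sub_le (hφ := hφ) hΩ hb hs hB
  obtain ⟨R, hR, hRΩ⟩ := exists_nearDiag_eq hb
  have hc : 0 < ‖u‖ + 1 := by positivity
  have h1 := hK R hR ((‖u‖ + 1)⁻¹ • u)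
    (by rw [W0.toFun_smul]; exact u.modular_inv_smul_le_one (lt_add_one _))
  rw [hRΩ] at h1
  have h2 : IntegrableOn (fun p : E N × E N => ((‖u‖ + 1)⁻¹ • u).toFun p.1
      - ((‖u‖ + 1)⁻¹ • u).toFun p.2) (Ω ×ˢ Ω) ((volume : Measure (E N)).prod volume) := by
    refine ⟨(aestronglyMeasurable_sub_toFun _).restrict, ?_⟩
    rw [hasFiniteIntegral_iff_norm]
    exact h1.trans_lt ENNReal.ofReal_lt_top
  refine (h2.const_mul (‖u‖ + 1)).congr (ae_of_all _ fun p => ?_)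
  simp only [W0.toFun_smul, Pi.smul_apply, smul_eq_mul]
  field_simp

theorem exists_integral_abs_sub_le (hΩ : IsOpen Ω) (hb : Bornology.IsBounded Ω) (hs : 0 ≤ s)
    (hB : FracBounded φ Ω) : ∃ K : ℝ, 0 ≤ K ∧ ∀ (r : ℝ), 0 < r → ∀ u : W0 hφ s Ω,
      ∫ p in nearDiag Ω r, |u.toFun p.1 - u.toFun p.2|
        ∂((volume : Measure (E N)).prod volume) ≤ K * (r ^ s * r ^ N) * ‖u‖ := by
  obtain ⟨K, hK0, hK⟩ := exists_lintegral_abs_sub_le (hφ := hφ) hΩ hb hs hB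
  refine ⟨K, hK0, fun r hr => W0.le_mul_norm_of_modular (fun c u hc => ?_) fun u hu => ?_⟩
  · rw [← integral_const_mul]
    congr 1
    funext p
    simp only [W0.toFun_smul, Pi.smul_apply, smul_eq_mul]
    rw [← mul_sub, abs_mul, abs_of_pos hc]
  · rw [integral_eq_lintegral_of_nonneg_ae (ae_of_all _ fun _ => abs_nonneg _)
      (aestronglyMeasurable_sub_toFun u).norm.restrict]
    exact ENNReal.toReal_le_of_le_ofReal (by positivity) (hK r hr u hu)

end Oscillation

section Poincare

variable {N : ℕ} {φ : E N → E N → ℝ → ℝ} {hφ : IsAdmissible φ} {s : ℝ} {Ω : Set (E N)}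

theorem W0.integrableOn (hΩ : IsOpen Ω) (hne : Ω.Nonempty) (hb : Bornology.IsBounded Ω)
    (hs : 0 ≤ s) (hB : FracBounded φ Ω) (u : W0 hφ s Ω) : IntegrableOn u.toFun Ω volume := by
  have h1 := integrableOn_sub_toFun hΩ hb hs hB u
  rw [IntegrableOn, ← Measure.prod_restrict] at h1
  have hne0 : (volume.restrict Ω : Measure (E N)) ≠ 0 := by
    rw [Ne, Measure.restrict_eq_zero]
    exact (hΩ.measure_pos volume hne).ne'
  have : NeBot (ae (volume.restrict Ω : Measure (E N))) := ae_neBot.2 hne0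
  obtain ⟨x, hx⟩ := h1.prod_right_ae.exists
  have : IsFiniteMeasure (volume.restrict Ω : Measure (E N)) :=
    ⟨by rw [Measure.restrict_apply_univ]; exact hb.measure_lt_top⟩
  refine ((integrable_const (u.toFun x)).sub hx).congr (ae_of_all _ fun y => ?_)
  simp

/-- `u` minus its mean over `Ω`. -/
def centered (u : W0 hφ s Ω) (x : E N) : ℝ := u.toFun x - ⨍ y in Ω, u.toFun y

theorem centered_sub_centered (u : W0 hφ s Ω) (x y : E N) :
    centered u x - centered u y = u.toFun x - u.toFun y := by simp [centered]

theorem integrableOn_centered (hΩ : IsOpen Ω) (hne : Ω.Nonempty) (hb : Bornology.IsBounded Ω)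
    (hs : 0 ≤ s) (hB : FracBounded φ Ω) (u : W0 hφ s Ω) : IntegrableOn (centered u) Ω volume :=
  (u.integrableOn hΩ hne hb hs hB).sub (integrableOn_const hb.measure_lt_top.ne)

/-- The fractional Poincaré inequality on `Ω`. -/
theorem exists_integral_abs_centered_le (hΩ : IsOpen Ω) (hne : Ω.Nonempty)
    (hb : Bornology.IsBounded Ω) (hs : 0 ≤ s) (hB : FracBounded φ Ω) :
    ∃ K : ℝ, 0 ≤ K ∧ ∀ u : W0 hφ s Ω, ∫ x in Ω, |centered u x| ≤ K * ‖u‖ := by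
  obtain ⟨K, hK0, hK⟩ := exists_integral_abs_sub_le (hφ := hφ) hΩ hb hs hB
  obtain ⟨R, hR, hRΩ⟩ := exists_nearDiag_eq hb
  set V : ℝ := volume.real Ω with hVdef
  have hV : 0 < V := ENNReal.toReal_pos (hΩ.measure_pos volume hne).ne' hb.measure_lt_top.ne
  refine ⟨V⁻¹ * (K * (R ^ s * R ^ N)), by positivity, fun u => ?_⟩
  have hu := u.integrableOn hΩ hne hb hs hB
  have hsub := integrableOn_sub_toFun hΩ hb hs hB u
  have hc := integrableOn_centered hΩ hne hb hs hB u
  have h1 := hK R hR u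
  rw [hRΩ, ← Measure.prod_restrict] at h1
  rw [IntegrableOn, ← Measure.prod_restrict] at hsub
  rw [integral_prod _ hsub.abs] at h1
  rw [mul_assoc, le_inv_mul_iff₀ hV, ← integral_const_mul]
  refine le_trans (integral_mono (hc.abs.const_mul V) hsub.abs.integral_prod_left
    fun x => ?_) h1
  have h2 : V * centered u x = ∫ y in Ω, (u.toFun x - u.toFun y) := by
    have hx : IntegrableOn (fun _ : E N => u.toFun x) Ω volume :=
      integrableOn_const hb.measure_lt_top.ne
    rw [integral_sub hx hu, setIntegral_const, centered,
      setAverage_eq, smul_eq_mul, smul_eq_mul, ← hVdef]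
    field_simp
  calc V * |centered u x| = |V * centered u x| := by rw [abs_mul, abs_of_pos hV]
    _ = |∫ y in Ω, (u.toFun x - u.toFun y)| := by rw [h2]
    _ ≤ _ := abs_integral_le_integral_abs

theorem centered_add (hΩ : IsOpen Ω) (hne : Ω.Nonempty)
    (hb : Bornology.IsBounded Ω) (hs : 0 ≤ s) (hB : FracBounded φ Ω) (u v : W0 hφ s Ω) (x : E N) :
    centered (u + v) x = centered u x + centered v x := by
  have h : ⨍ y in Ω, (u + v).toFun y = (⨍ y in Ω, u.toFun y) + ⨍ y in Ω, v.toFun y := by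
    simp only [W0.toFun_add, Pi.add_apply, setAverage_eq]
    rw [integral_add (u.integrableOn hΩ hne hb hs hB) (v.integrableOn hΩ hne hb hs hB), smul_add]
  rw [centered, h, W0.toFun_add, Pi.add_apply, centered, centered]
  ring

theorem centered_smul (c : ℝ) (u : W0 hφ s Ω) (x : E N) :
    centered (c • u) x = c * centered u x := by
  simp only [centered, W0.toFun_smul, Pi.smul_apply, smul_eq_mul, setAverage_eq,
    integral_const_mul]
  ring

/-- Integration of `u` minus its mean over a subset of `Ω` is a bounded functional. -/
theorem exists_dual_eq_setIntegral_centered (hΩ : IsOpen Ω) (hne : Ω.Nonempty)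
    (hb : Bornology.IsBounded Ω) (hs : 0 ≤ s) (hB : FracBounded φ Ω) {A : Set (E N)}
    (hA : A ⊆ Ω) :
    ∃ f : StrongDual ℝ (W0 hφ s Ω), ∀ u, f u = ∫ x in A, centered u x := by
  obtain ⟨K, hK0, hK⟩ := exists_integral_abs_centered_le (hφ := hφ) hΩ hne hb hs hB
  have hi := fun u : W0 hφ s Ω => (integrableOn_centered hΩ hne hb hs hB u)
  refine ⟨LinearMap.mkContinuousOfExistsBound
    { toFun := fun u => ∫ x in A, centered u x
      map_add' := fun u v => by
        simp only [centered_add hΩ hne hb hs hB]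
        exact integral_add ((hi u).mono_set hA) ((hi v).mono_set hA)
      map_smul' := fun c u => by
        simp only [centered_smul, integral_const_mul, RingHom.id_apply, smul_eq_mul] }
    ⟨K, fun u => ?_⟩, fun u => rfl⟩
  refine (abs_integral_le_integral_abs.trans ?_).trans (hK u)
  exact setIntegral_mono_set (hi u).abs (ae_of_all _ fun _ => abs_nonneg _) hA.eventuallyLE

end Poincare

section Compactness

variable {N : ℕ} {φ : E N → E N → ℝ → ℝ} {hφ : IsAdmissible φ} {s : ℝ} {Ω : Set (E N)}

theorem measurableSet_near (r : ℝ) : MeasurableSet {p : E N × E N | ‖p.1 - p.2‖ < r} :=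
  measurableSet_lt (measurable_fst.sub measurable_snd).norm measurable_const

theorem setIntegral_indicator_near {x : E N} {r : ℝ} (hx : Metric.ball x r ⊆ Ω)
    (G : E N × E N → ℝ) :
    ∫ y in Ω, {p : E N × E N | ‖p.1 - p.2‖ < r}.indicator G (x, y)
      = ∫ y in Metric.ball x r, G (x, y) := by
  have h : (fun y => {p : E N × E N | ‖p.1 - p.2‖ < r}.indicator G (x, y))
      = (Metric.ball x r).indicator fun y => G (x, y) := by
    funext y
    by_cases hy : y ∈ Metric.ball x r
    · rw [indicator_of_mem hy, indicator_of_mem]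
      rw [mem_ball_iff_norm, norm_sub_rev] at hy
      exact hy
    · rw [indicator_of_notMem hy, indicator_of_notMem]
      rw [mem_ball_iff_norm, norm_sub_rev] at hy
      exact hy
  rw [h, setIntegral_indicator measurableSet_ball, inter_eq_right.2 hx]

theorem measureReal_mul_abs_centered_le (hΩ : IsOpen Ω) (hne : Ω.Nonempty)
    (hb : Bornology.IsBounded Ω) (hs : 0 ≤ s) (hB : FracBounded φ Ω) (u : W0 hφ s Ω) {x : E N}
    {r : ℝ} (hx : Metric.ball x r ⊆ Ω) :
    volume.real (Metric.ball x r) * |centered u x| ≤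
      (∫ y in Metric.ball x r, |u.toFun x - u.toFun y|) +
        |∫ y in Metric.ball x r, centered u y| := by
  have h1 : IntegrableOn (centered u) (Metric.ball x r) volume :=
    (integrableOn_centered hΩ hne hb hs hB u).mono_set hx
  have h2 : IntegrableOn (fun _ => centered u x) (Metric.ball x r) volume :=
    integrableOn_const measure_ball_lt_top.ne
  have h3 : volume.real (Metric.ball x r) * centered u x
      = (∫ y in Metric.ball x r, (u.toFun x - u.toFun y)) +
        ∫ y in Metric.ball x r, centered u y := by
    simp only [← centered_sub_centered]
    rw [integral_sub h2 h1, setIntegral_const, smul_eq_mul, sub_add_cancel]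
  rw [← abs_of_nonneg (measureReal_nonneg (μ := volume) (s := Metric.ball x r)), ← abs_mul, h3]
  refine (abs_add_le _ _).trans ?_
  gcongr
  exact abs_integral_le_integral_abs

theorem tendsto_setIntegral_abs_ballIntegral (hΩ : IsOpen Ω) (hne : Ω.Nonempty)
    (hb : Bornology.IsBounded Ω) (hs : 0 ≤ s) (hB : FracBounded φ Ω)
    {w : ℕ → W0 hφ s Ω} {M : ℝ} (hM : ∀ n, ‖w n‖ ≤ M)
    (hw : ∀ f : StrongDual ℝ (W0 hφ s Ω), Tendsto (fun n => f (w n)) atTop (𝓝 0))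
    {S : Set (E N)} (hS : IsCompact S) {r : ℝ}
    (hr : ∀ x ∈ S, Metric.ball x r ⊆ Ω) :
    (∀ n, IntegrableOn (fun x => |∫ y in Metric.ball x r, centered (w n) y|) S volume) ∧
    Tendsto (fun n => ∫ x in S, |∫ y in Metric.ball x r, centered (w n) y|) atTop (𝓝 0) := by
  obtain ⟨K, hK0, hK⟩ := exists_integral_abs_centered_le (hφ := hφ) hΩ hne hb hs hB
  have hint := fun n => integrableOn_centered hΩ hne hb hs hB (w n)
  have hmeas : ∀ n, AEStronglyMeasurable
      (fun x => |∫ y in Metric.ball x r, centered (w n) y|) (volume.restrict S) := by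
    intro n
    have h1 : AEStronglyMeasurable (fun p : E N × E N => centered (w n) p.2)
        ((volume.restrict S).prod (volume.restrict Ω)) :=
      (hint n).aestronglyMeasurable.comp_quasiMeasurePreserving Measure.quasiMeasurePreserving_snd
    have h2 := (h1.indicator (measurableSet_near r)).integral_prod_right'
    refine (h2.congr ?_).norm
    filter_upwards [ae_restrict_mem hS.measurableSet] with x hx
    exact setIntegral_indicator_near (hr x hx) _
  have hbound : ∀ n, ∀ᵐ x ∂(volume.restrict S),
      ‖|∫ y in Metric.ball x r, centered (w n) y|‖ ≤ K * M := by
    intro n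
    filter_upwards [ae_restrict_mem hS.measurableSet] with x hx
    rw [norm_abs_eq_norm, Real.norm_eq_abs]
    calc |∫ y in Metric.ball x r, centered (w n) y|
        ≤ ∫ y in Metric.ball x r, |centered (w n) y| := abs_integral_le_integral_abs
      _ ≤ ∫ y in Ω, |centered (w n) y| := setIntegral_mono_set (hint n).abs
        (ae_of_all _ fun _ => abs_nonneg _) (hr x hx).eventuallyLE
      _ ≤ K * ‖w n‖ := hK _
      _ ≤ K * M := by gcongr; exact hM n
  have hconst : IntegrableOn (fun _ : E N => K * M) S volume :=
    integrableOn_const hS.measure_lt_top.ne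
  refine ⟨fun n => hconst.mono' (hmeas n) (hbound n), ?_⟩
  have := tendsto_integral_of_dominated_convergence (μ := volume.restrict S)
    (f := fun _ => (0 : ℝ)) _ hmeas hconst hbound ?_
  · simpa using this
  · filter_upwards [ae_restrict_mem hS.measurableSet] with x hx
    obtain ⟨f, hf⟩ := exists_dual_eq_setIntegral_centered (hφ := hφ) hΩ hne hb hs hB (hr x hx)
    have := (hw f).abs
    simpa only [hf, abs_zero] using this

/-- Weak convergence implies local convergence in `L¹`, up to constants. -/
theorem tendsto_setIntegral_abs_centered (hΩ : IsOpen Ω) (hne : Ω.Nonempty)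
    (hb : Bornology.IsBounded Ω) (hs : 0 < s) (hB : FracBounded φ Ω)
    {w : ℕ → W0 hφ s Ω} {M : ℝ} (hM : ∀ n, ‖w n‖ ≤ M)
    (hw : ∀ f : StrongDual ℝ (W0 hφ s Ω), Tendsto (fun n => f (w n)) atTop (𝓝 0))
    {S : Set (E N)} (hS : IsCompact S) (hSΩ : S ⊆ Ω) :
    Tendsto (fun n => ∫ x in S, |centered (w n) x|) atTop (𝓝 0) := by
  obtain ⟨K, hK0, hK⟩ := exists_integral_abs_sub_le (hφ := hφ) hΩ hb hs.le hB
  obtain ⟨δ, hδ, hδΩ⟩ := hS.exists_thickening_subset_open hΩ hSΩ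
  have hM0 : 0 ≤ M := (norm_nonneg _).trans (hM 0)
  set V := volume.real (Metric.ball (0 : E N) 1) with hVdef
  have hV : 0 < V :=
    ENNReal.toReal_pos (Metric.measure_ball_pos volume 0 one_pos).ne' measure_ball_lt_top.ne
  refine (tendsto_order.2 ⟨fun a ha => Eventually.of_forall fun n =>
    ha.trans_le (integral_nonneg fun _ => abs_nonneg _), fun ε hε => ?_⟩)
  have hsmall : ∀ᶠ r : ℝ in 𝓝[>] 0, V⁻¹ * (K * M) * r ^ s < ε / 2 := by
    have h1 : Tendsto (fun r : ℝ => V⁻¹ * (K * M) * r ^ s) (𝓝[>] 0) (𝓝 0) := by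
      have := ((Real.continuous_rpow_const hs.le).tendsto 0).const_mul (V⁻¹ * (K * M))
      rw [Real.zero_rpow hs.ne', mul_zero] at this
      exact this.mono_left nhdsWithin_le_nhds
    exact (tendsto_order.1 h1).2 _ (by positivity)
  obtain ⟨r, hrε, hr0, hrδ⟩ := (hsmall.and (Ioo_mem_nhdsGT hδ)).exists
  have hrΩ : ∀ x ∈ S, Metric.ball x r ⊆ Ω := fun x hx =>
    ((Metric.ball_subset_ball hrδ.le).trans (Metric.ball_subset_thickening hx δ)).trans hδΩ
  obtain ⟨hgi, hg⟩ := tendsto_setIntegral_abs_ballIntegral hΩ hne hb hs.le hB hM hw hS hrΩ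
  have hVr : ∀ x : E N, volume.real (Metric.ball x r) = r ^ N * V := by
    intro x
    rw [measureReal_def, Measure.addHaar_ball_of_pos volume x hr0, finrank_euclideanSpace_fin,
      ENNReal.toReal_mul, ENNReal.toReal_ofReal (by positivity), hVdef, measureReal_def]
  have hrN : 0 < r ^ N := by positivity
  have hev := (tendsto_order.1 hg).2 (r ^ N * V * (ε / 2)) (by positivity)
  filter_upwards [hev] with n hn
  set T : Set (E N × E N) := {p | ‖p.1 - p.2‖ < r} with hT
  set G : E N × E N → ℝ := fun p => |(w n).toFun p.1 - (w n).toFun p.2| with hG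
  have hsub := integrableOn_sub_toFun hΩ hb hs.le hB (w n)
  have hGi : Integrable (T.indicator G) ((volume.restrict Ω).prod (volume.restrict Ω)) := by
    rw [Measure.prod_restrict]
    exact hsub.abs.indicator (measurableSet_near r)
  have hH := hGi.integral_prod_left
  have hGnn : ∀ p, 0 ≤ T.indicator G p := indicator_nonneg fun _ _ => abs_nonneg _
  have hHle : ∫ x in S, ∫ y in Ω, T.indicator G (x, y) ≤ K * (r ^ s * r ^ N) * M := by
    calc ∫ x in S, ∫ y in Ω, T.indicator G (x, y)
        ≤ ∫ x in Ω, ∫ y in Ω, T.indicator G (x, y) := setIntegral_mono_set hH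
          (ae_of_all _ fun _ => integral_nonneg fun _ => hGnn _) hSΩ.eventuallyLE
      _ = ∫ p in nearDiag Ω r, G p ∂((volume : Measure (E N)).prod volume) := by
        rw [← integral_prod _ hGi, Measure.prod_restrict,
          setIntegral_indicator (measurableSet_near r)]
        rfl
      _ ≤ K * (r ^ s * r ^ N) * ‖w n‖ := hK r hr0 _
      _ ≤ K * (r ^ s * r ^ N) * M := by gcongr; exact hM n
  have hmain : r ^ N * V * ∫ x in S, |centered (w n) x| ≤
      (∫ x in S, ∫ y in Ω, T.indicator G (x, y)) +
        ∫ x in S, |∫ y in Metric.ball x r, centered (w n) y| := by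
    have hHS : IntegrableOn (fun x => ∫ y in Ω, T.indicator G (x, y)) S volume :=
      IntegrableOn.mono_set hH hSΩ
    rw [← integral_const_mul, ← integral_add hHS (hgi n)]
    refine setIntegral_mono_on
      (((integrableOn_centered hΩ hne hb hs.le hB (w n)).mono_set hSΩ).abs.const_mul _)
      (hHS.add (hgi n)) hS.measurableSet fun x hx => ?_
    rw [setIntegral_indicator_near (hrΩ x hx), ← hVr x]
    exact measureReal_mul_abs_centered_le hΩ hne hb hs.le hB (w n) (hrΩ x hx)
  have h1 : r ^ N * V * ∫ x in S, |centered (w n) x| < r ^ N * V * ε := by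
    calc r ^ N * V * ∫ x in S, |centered (w n) x|
        < K * (r ^ s * r ^ N) * M + r ^ N * V * (ε / 2) := by linarith
      _ = r ^ N * V * (V⁻¹ * (K * M) * r ^ s) + r ^ N * V * (ε / 2) := by field_simp
      _ ≤ r ^ N * V * (ε / 2) + r ^ N * V * (ε / 2) := by gcongr
      _ = r ^ N * V * ε := by ring
  exact lt_of_mul_lt_mul_left h1 (by positivity)

theorem tendstoInMeasure_centered (hΩ : IsOpen Ω) (hne : Ω.Nonempty)
    (hb : Bornology.IsBounded Ω) (hs : 0 < s) (hB : FracBounded φ Ω)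
    {w : ℕ → W0 hφ s Ω} {M : ℝ} (hM : ∀ n, ‖w n‖ ≤ M)
    (hw : ∀ f : StrongDual ℝ (W0 hφ s Ω), Tendsto (fun n => f (w n)) atTop (𝓝 0)) :
    TendstoInMeasure (volume.restrict Ω) (fun n => centered (w n)) atTop (fun _ => (0 : ℝ)) := by
  rw [tendstoInMeasure_iff_norm]
  intro η hη
  simp only [sub_zero, Real.norm_eq_abs]
  rw [ENNReal.tendsto_nhds_zero]
  intro ε hε
  obtain ⟨S, hSΩ, hS, hSε⟩ := hΩ.measurableSet.exists_isCompact_sdiff_lt (μ := volume)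
    hb.measure_lt_top.ne (ENNReal.half_pos hε.ne').ne'
  have hint := fun n =>
    (integrableOn_centered hΩ hne hb hs.le hB (w n)).mono_set hSΩ
  have h1 : Tendsto (fun n => ENNReal.ofReal (∫ x in S, |centered (w n) x|) / ENNReal.ofReal η)
      atTop (𝓝 0) := by
    have h2 := ENNReal.Tendsto.div_const (ENNReal.tendsto_ofReal
      (tendsto_setIntegral_abs_centered hΩ hne hb hs hB hM hw hS hSΩ)) (b := ENNReal.ofReal η)
        (Or.inr (ENNReal.ofReal_pos.2 hη).ne')
    simpa using h2
  filter_upwards [ENNReal.tendsto_nhds_zero.1 h1 _ (ENNReal.half_pos hε.ne')] with n hn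
  calc (volume.restrict Ω) {x | η ≤ |centered (w n) x|}
      ≤ (volume.restrict (Ω \ S)) {x | η ≤ |centered (w n) x|}
        + (volume.restrict S) {x | η ≤ |centered (w n) x|} := by
        rw [← Measure.add_apply]
        have h2 := Measure.restrict_union_le (μ := (volume : Measure (E N))) (Ω \ S) S
        rw [sdiff_union_of_subset hSΩ] at h2
        exact h2 _
    _ ≤ ε / 2 + ε / 2 := by
        gcongr
        · exact (measure_mono (subset_univ _)).trans
            (by rw [Measure.restrict_apply_univ]; exact hSε.le)
        · refine le_trans ?_ hn
          rw [ofReal_integral_eq_lintegral_ofReal (hint n).abs (ae_of_all _ fun _ => abs_nonneg _)]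
          refine le_trans (measure_mono fun x hx => ?_) (meas_ge_le_lintegral_div
            (hint n).abs.aestronglyMeasurable.aemeasurable.ennreal_ofReal
            (ENNReal.ofReal_pos.2 hη).ne' ENNReal.ofReal_ne_top)
          exact ENNReal.ofReal_le_ofReal hx
    _ = ε := ENNReal.add_halves ε

theorem exists_subseq_tendsto_Ds (hΩ : IsOpen Ω) (hne : Ω.Nonempty)
    (hb : Bornology.IsBounded Ω) (hs : 0 < s) (hB : FracBounded φ Ω)
    {w : ℕ → W0 hφ s Ω} {M : ℝ} (hM : ∀ n, ‖w n‖ ≤ M)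
    (hw : ∀ f : StrongDual ℝ (W0 hφ s Ω), Tendsto (fun n => f (w n)) atTop (𝓝 0)) :
    ∃ ns : ℕ → ℕ, StrictMono ns ∧ ∀ᵐ p ∂(gagliardoMeasure Ω),
      Tendsto (fun k => Ds s (w (ns k)).toFun p) atTop (𝓝 0) := by
  obtain ⟨ns, hns, hae⟩ :=
    (tendstoInMeasure_centered hΩ hne hb hs hB hM hw).exists_seq_tendsto_ae
  refine ⟨ns, hns, ?_⟩
  refine (withDensity_absolutelyContinuous _ _).ae_le ?_
  rw [← Measure.prod_restrict]
  filter_upwards [Measure.quasiMeasurePreserving_fst.ae hae,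
    Measure.quasiMeasurePreserving_snd.ae hae] with p h1 h2
  have h3 := (h1.sub h2).div_const (‖p.1 - p.2‖ ^ s)
  simp only [centered_sub_centered, sub_zero, zero_div] at h3
  exact h3

end Compactness

section SPlus

variable {N : ℕ} {φ : E N → E N → ℝ → ℝ} {hφ : IsAdmissible φ} {s : ℝ} {Ω : Set (E N)}

theorem exists_norm_le_of_tendsto_dual {X : Type*} [SeminormedAddCommGroup X] [NormedSpace ℝ X]
    {u : ℕ → X} {u₀ : X}
    (h : ∀ f : StrongDual ℝ X, Tendsto (fun n => f (u n)) atTop (𝓝 (f u₀))) :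
    ∃ M : ℝ, ∀ n, ‖u n‖ ≤ M := by
  obtain ⟨C, hC⟩ := banach_steinhaus
    (g := fun n => NormedSpace.inclusionInDoubleDual ℝ X (u n)) fun f => by
      obtain ⟨C, hC⟩ := (h f).norm.bddAbove_range
      exact ⟨C, fun n => hC ⟨n, rfl⟩⟩
  exact ⟨C, fun n => by
    rw [← (NormedSpace.inclusionInDoubleDualLi (E := X) ℝ).norm_map]; exact hC n⟩

theorem tendsto_zero_of_modular_tendsto_zero {w : ℕ → W0 hφ s Ω} {k : ℝ} (hk : 0 < k)
    (h : Tendsto (fun n => modular φ s Ω (k • (w n).toFun)) atTop (𝓝 0)) :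
    Tendsto w atTop (𝓝 0) := by
  rw [tendsto_zero_iff_norm_tendsto_zero, Metric.tendsto_atTop']
  intro ε hε
  obtain ⟨C, hC, hle⟩ := hφ.exists_modular_smul_le s Ω ((ε / 2)⁻¹ * k⁻¹)
  have h1 : Tendsto (fun n => ENNReal.ofReal C * modular φ s Ω (k • (w n).toFun)) atTop (𝓝 0) := by
    simpa using ENNReal.Tendsto.const_mul h (Or.inr (ENNReal.ofReal_ne_top (r := C)))
  obtain ⟨n₀, hn₀⟩ := eventually_atTop.1 (ENNReal.tendsto_nhds_zero.1 h1 1 one_pos)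
  refine ⟨n₀, fun n hn => ?_⟩
  have h2 := (hle (k • (w n).toFun)).trans (hn₀ n hn.le)
  rw [smul_smul, mul_assoc, inv_mul_cancel₀ hk.ne', mul_one] at h2
  have h3 := (w n).norm_le_of_modular_le_one (half_pos hε) h2
  rw [Real.dist_0_eq_abs, abs_of_nonneg (norm_nonneg _)]
  linarith

/-- Pointwise convergence of `D_s u_n` and `limsup J(u_n) ≤ J(u₀)` imply strong convergence. -/
theorem tendsto_of_ae_tendsto_of_J_le {u : ℕ → W0 hφ s Ω} {u₀ : W0 hφ s Ω}
    (hae : ∀ᵐ p ∂(gagliardoMeasure Ω),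
      Tendsto (fun k => Ds s (u k - u₀).toFun p) atTop (𝓝 0))
    (hJ : ∀ ε : ℝ, 0 < ε → ∀ᶠ n in atTop, J (u n) ≤ J u₀ + ε) :
    Tendsto u atTop (𝓝 u₀) := by
  set ν := gagliardoMeasure Ω
  let P : W0 hφ s Ω → E N × E N → ℝ := fun v p => Phi φ p.1 p.2 (Ds s v.toFun p)
  let w : ℕ → W0 hφ s Ω := fun n => (1 / 2 : ℝ) • (u n - u₀)
  let g : ℕ → E N × E N → ℝ := fun n p => (1 / 2) * P (u n) p + (1 / 2) * P u₀ p - P (w n) p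
  have hPi : ∀ v, Integrable (P v) ν := fun v => v.integrable_Phi
  have hg0 : ∀ n p, 0 ≤ g n p := by
    intro n p
    have h1 := hφ.Phi_convex p.1 p.2 (Ds s (u n).toFun p) (-Ds s u₀.toFun p) (c := 1 / 2)
      (d := 1 / 2) (by norm_num) (by norm_num) (by norm_num)
    rw [← Phi_abs p.1 p.2 (-Ds s u₀.toFun p), abs_neg, Phi_abs] at h1
    have h2 : P (w n) p = Phi φ p.1 p.2
        (1 / 2 * Ds s (u n).toFun p + 1 / 2 * -Ds s u₀.toFun p) := by
      simp only [P, w, Ds_toFun_smul, Ds_toFun_sub]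
      congr 1
      ring
    have h3 : P (w n) p ≤ 1 / 2 * P (u n) p + 1 / 2 * P u₀ p := h2 ▸ h1
    simp only [g]
    linarith
  have hgi : ∀ n, Integrable (g n) ν := fun n =>
    (((hPi _).const_mul _).add ((hPi _).const_mul _)).sub (hPi _)
  have hgint : ∀ n, ∫ p, g n p ∂ν = (1 / 2) * J (u n) + (1 / 2) * J u₀ - J (w n) := by
    intro n
    simp only [J_eq_integral]
    calc ∫ p, g n p ∂ν = ∫ p, (1 / 2 * P (u n) p + 1 / 2 * P u₀ p) ∂ν - ∫ p, P (w n) p ∂ν :=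
          integral_sub (((hPi _).const_mul _).add ((hPi _).const_mul _)) (hPi _)
      _ = _ := by
        rw [integral_add ((hPi _).const_mul _) ((hPi _).const_mul _), integral_const_mul,
          integral_const_mul]
  have hglim : ∀ᵐ p ∂ν, Tendsto (fun n => g n p) atTop (𝓝 (P u₀ p)) := by
    filter_upwards [hae] with p hp
    have hc := (hφ.Phi_continuous p.1 p.2)
    have h1 : Tendsto (fun n => P (u n) p) atTop (𝓝 (P u₀ p)) := by
      refine (hc.tendsto _).comp ?_
      have := hp.add_const (Ds s u₀.toFun p)
      simpa [Ds_toFun_sub] using this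
    have h2 : Tendsto (fun n => P (w n) p) atTop (𝓝 0) := by
      have h3 := (hc.tendsto 0).comp (show Tendsto (fun n => Ds s (w n).toFun p) atTop (𝓝 0) by
        simpa only [w, Ds_toFun_smul, mul_zero] using hp.const_mul (1 / 2))
      rwa [Phi_zero] at h3
    have h4 := ((h1.const_mul (1 / 2)).add_const (1 / 2 * P u₀ p)).sub h2
    have h5 : 1 / 2 * P u₀ p + 1 / 2 * P u₀ p - 0 = P u₀ p := by ring
    rwa [h5] at h4
  have hfatou : ENNReal.ofReal (J u₀) ≤
      liminf (fun n => ENNReal.ofReal (∫ p, g n p ∂ν)) atTop := by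
    have h1 : ENNReal.ofReal (J u₀) = ∫⁻ p, liminf (fun n => ENNReal.ofReal (g n p)) atTop ∂ν := by
      rw [J_eq_integral, ofReal_integral_eq_lintegral_ofReal (hPi u₀)
        (ae_of_all _ fun _ => hφ.Phi_nonneg _ _ _)]
      refine lintegral_congr_ae ?_
      filter_upwards [hglim] with p hp
      exact (ENNReal.tendsto_ofReal hp).liminf_eq.symm
    rw [h1]
    refine (lintegral_liminf_le' fun n =>
      (hgi n).aestronglyMeasurable.aemeasurable.ennreal_ofReal).trans_eq ?_
    congr 1
    funext n
    rw [ofReal_integral_eq_lintegral_ofReal (hgi n) (ae_of_all _ (hg0 n))]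
  have hJ0 : ∀ v : W0 hφ s Ω, 0 ≤ J v := fun v => ENNReal.toReal_nonneg
  have hJw : Tendsto (fun n => J (w n)) atTop (𝓝 0) := by
    refine tendsto_order.2 ⟨fun a ha => Eventually.of_forall fun n => ha.trans_le (hJ0 _),
      fun ε hε => ?_⟩
    have hlow : ∀ᶠ n in atTop, J u₀ - ε / 4 < ∫ p, g n p ∂ν := by
      rcases lt_or_ge (J u₀ - ε / 4) 0 with hneg | hpos
      · exact Eventually.of_forall fun n => hneg.trans_le (integral_nonneg (hg0 n))
      · have h1 : ENNReal.ofReal (J u₀ - ε / 4) < ENNReal.ofReal (J u₀) :=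
          (ENNReal.ofReal_lt_ofReal_iff (by linarith)).2 (by linarith)
        filter_upwards [eventually_lt_of_lt_liminf (h1.trans_le hfatou)] with n hn
        exact ENNReal.ofReal_lt_ofReal_iff_of_nonneg hpos |>.1 hn
    filter_upwards [hlow, hJ ε hε] with n h1 h2
    rw [hgint] at h1
    linarith
  have hmod : Tendsto (fun n => modular φ s Ω ((1 / 2 : ℝ) • (u n - u₀).toFun)) atTop (𝓝 0) := by
    have h1 := ENNReal.tendsto_ofReal hJw
    rw [ENNReal.ofReal_zero] at h1
    refine h1.congr fun n => ?_
    rw [J, ENNReal.ofReal_toReal (w n).modular_lt_top.ne]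
    rfl
  have := tendsto_zero_of_modular_tendsto_zero (by norm_num) hmod
  simpa using this.add_const u₀

theorem hasSPlus_gateauxDeriv (hΩ : IsOpen Ω) (hne : Ω.Nonempty)
    (hb : Bornology.IsBounded Ω) (hs : 0 < s) (hB : FracBounded φ Ω) :
    HasSPlus (gateauxDeriv (hφ := hφ) (s := s) (Ω := Ω)) := by
  intro u u₀ hweak hlim
  obtain ⟨M, hM⟩ := exists_norm_le_of_tendsto_dual hweak
  have hJ : ∀ ε : ℝ, 0 < ε → ∀ᶠ n in atTop, J (u n) ≤ J u₀ + ε := by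
    intro ε hε
    have h1 : limsup (fun n => ((gateauxDeriv (u n) (u n - u₀) : ℝ) : EReal)) atTop < (ε : EReal) :=
      hlim.trans_lt (by exact_mod_cast hε)
    filter_upwards [eventually_lt_of_limsup_lt h1] with n hn
    have h2 : gateauxDeriv (u n) (u n - u₀) < ε := by exact_mod_cast hn
    have h3 := gateauxDeriv_le_sub (u n) u₀
    rw [← neg_sub (u n) u₀, map_neg] at h3
    linarith
  refine tendsto_of_subseq_tendsto fun ns hns => ?_
  obtain ⟨ms, hms, hae⟩ := exists_subseq_tendsto_Ds hΩ hne hb hs hB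
    (w := fun n => u (ns n) - u₀) (M := M + ‖u₀‖)
    (fun n => (norm_sub_le _ _).trans (by gcongr; exact hM _))
    (fun f => by
      have := ((hweak f).comp hns).sub_const (f u₀)
      simpa using this)
  exact ⟨ms, tendsto_of_ae_tendsto_of_J_le hae fun ε hε =>
    (hns.comp hms.tendsto_atTop).eventually (hJ ε hε)⟩

end SPlus

end FracMusielak

end

theorem theorem3 {N : ℕ} (hN : 2 ≤ N)
    {Ω : Set (FracMusielak.E N)} (hΩ_open : IsOpen Ω) (hΩ_conn : IsConnected Ω)
    (hΩ_bdd : Bornology.IsBounded Ω)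
    {s : ℝ} (hs : s ∈ Set.Ioo (0 : ℝ) 1)
    {φ : FracMusielak.E N → FracMusielak.E N → ℝ → ℝ} (hφ : FracMusielak.IsAdmissible φ)
    (hB : FracMusielak.FracBounded φ Ω) :
    ∃ J' : FracMusielak.W0 hφ s Ω → StrongDual ℝ (FracMusielak.W0 hφ s Ω),
      FracMusielak.IsGateauxDeriv (FracMusielak.J (hφ := hφ) (s := s) (Ω := Ω)) J' ∧
      FracMusielak.HasSPlus J' :=
  ⟨FracMusielak.gateauxDeriv, FracMusielak.hasLineDerivAt_J,
    FracMusielak.hasSPlus_gateauxDeriv hΩ_open hΩ_conn.nonempty hΩ_bdd hs.1 hB⟩
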